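/- **Definitions.** A constraint language $\Gamma$ over a finite set $\mathcal D$ is a set of relations over $\mathcal D$ (of arbitrary finite arities); its conservative extension $\overline\Gamma$ is $\Gamma$ together with all unary relations over $\mathcal D$. A CSP instance $I=(\mathcal X,\mathcal D,\mathcal C)$ consists of a finite set $\mathcal X$ of variables, a finite set $\mathcal D$ of values and a finite set $\mathcal C$ of constraints $(S_C,R_C)$, where $R_C$ is a relation over $\mathcal D$ of some arity $k$, given as an explicit list of tuples, and $S_C\in\mathcal X^k$; it is satisfiable if there is $\phi:\mathcal X\to\mathcal D$ with $\phi(S_C)\in R_C$ for all $C\in\mathcal C$. The language of $I$ is $\mathcal L(I)=\{R_C : C\in\mathcal C\}$. An operation $f:\mathcal D^k\to\mathcal D$ is a polymorphism of $\Gamma$ if every $R\in\Gamma$ is closed under applying $f$ componentwise to $k$ tuples of $R$. The polymorphisms of $\overline\Gamma$ are exactly the conservative polymorphisms of $\Gamma$, i.e. those with $f(x_1,\dots,x_k)\in\{x_1,\dots,x_k\}$ for all $x_1,\dots,x_k\in\mathcal D$. A linear strong Mal'tsev condition $\mathcal M$ is a finite set of identities of the form $f(x_1,\dots,x_k)\approx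 g(y_1,\dots,y_c)$ or $f(x_1,\dots,x_k)\approx y$, where $f,g$ belong to a finite set $f_1,\dots,f_m$ of operation symbols of fixed arities and the $x_i$, $y_j$, $y$ are (not necessarily distinct) variables. Operations on $\mathcal D$ satisfy $\mathcal M$ if every identity holds for all assignments of values to its variables. A language satisfies $\mathcal M$ if it has polymorphisms $f_1,\dots,f_m$ that satisfy $\mathcal M$. A *uniform* polynomial-time algorithm for $\mathcal M$ for conservative languages is a single algorithm that decides in polynomial time whether $I$ is satisfiable, for every CSP instance $I$ such that $\overline{\mathcal L(I)}$ satisfies $\mathcal M$. A *semiuniform* polynomial-time algorithm for $\mathcal M$ for conservative languages is a single algorithm that decides in polynomial time whether $I$ is satisfiable, for every CSP instance $I$ that is given together with the tables of polymorphisms $f_1,\dots,f_m$ of $\overline{\mathcal L(I)}$ that satisfy $\mathcal M$. In both cases the running time is polynomial in the size of the whole input, with $\mathcal M$ fixed and $\mathcal X$, $\mathcal D$ part of the input, and nothing is required on other inputs. **Statement.** Let $\mathcal M$ be a linear strong Mal'tsev condition. If $\mathcal M$ has a semiuniform polynomial-time algorithm for conservative languages, then $\mathcal M$ also has a uniform polynomial-time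 algorithm for conservative languages. -/

import Mathlib

namespace ConsCSP

/-! ### Machine model: while-programs on binary trees, with a step count

Every elementary operation costs one step. A step allocates at most one tree node and
looks at one node only, so, storing trees as shared pointer structures, `t` steps can be carried
out by a Turing machine in time polynomial in `t` and in the size of the input; conversely each
step of a Turing machine takes a bounded number of steps here. Hence the decision problems
that are solvable in polynomial time are the usual ones. -/

/-- Binary trees. -/
inductive Data : Type
  | nil : Data
  | cons : Data → Data → Data

namespace Data

/-- The number of nodes of a tree. -/
def size : Data → ℕ
  | nil => 1
  | cons a b => size a + size b + 1

/-- Left subtree (`nil` for a leaf). -/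
def hd : Data → Data
  | nil => nil
  | cons a _ => a

/-- Right subtree (`nil` for a leaf). -/
def tl : Data → Data
  | nil => nil
  | cons _ b => b

/-- Unary encoding of natural numbers. -/
def ofNat : ℕ → Data
  | 0 => nil
  | n + 1 => cons nil (ofNat n)

/-- Encoding of lists of trees. -/
def ofList : List Data → Data
  | [] => nil
  | a :: l => cons a (ofList l)

end Data

/-- Programs; each one maps a tree to a tree (if it halts). -/
inductive Prog : Type
  /-- return the input -/
  | id : Prog
  /-- return the leaf -/
  | nil : Prog
  /-- left subtree of the input -/
  | hd : Prog
  /-- right subtree of the input -/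
  | tl : Prog
  /-- run both programs on the input and join their results -/
  | cons (p q : Prog) : Prog
  /-- run `p`, then run `q` on the result of `p` -/
  | seq (p q : Prog) : Prog
  /-- run `c` on the input; if its result is not the leaf, run `p` on the input, otherwise `q` -/
  | ite (c p q : Prog) : Prog
  /-- while `c` does not return the leaf on the current tree, replace the tree by the result
  of `p` on it -/
  | loop (c p : Prog) : Prog

/-- `Runs p x y t`: the program `p` halts on input `x` with output `y` after exactly `t` steps. -/
inductive Prog.Runs : Prog → Data → Data → ℕ → Prop
  | id (x : Data) : Runs .id x x 1
  | nil (x : Data) : Runs .nil x .nil 1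
  | hd (x : Data) : Runs .hd x x.hd 1
  | tl (x : Data) : Runs .tl x x.tl 1
  | cons {p q : Prog} {x a b : Data} {s t : ℕ} :
      Runs p x a s → Runs q x b t → Runs (.cons p q) x (.cons a b) (s + t + 1)
  | seq {p q : Prog} {x y z : Data} {s t : ℕ} :
      Runs p x y s → Runs q y z t → Runs (.seq p q) x z (s + t + 1)
  | iteTrue {c p q : Prog} {x a b y : Data} {s t : ℕ} :
      Runs c x (.cons a b) s → Runs p x y t → Runs (.ite c p q) x y (s + t + 1)
  | iteFalse {c p q : Prog} {x y : Data} {s t : ℕ} :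
      Runs c x .nil s → Runs q x y t → Runs (.ite c p q) x y (s + t + 1)
  | loopStop {c p : Prog} {x : Data} {s : ℕ} :
      Runs c x .nil s → Runs (.loop c p) x x (s + 1)
  | loopStep {c p : Prog} {x a b y z : Data} {s t u : ℕ} :
      Runs c x (.cons a b) s → Runs p x y t → Runs (.loop c p) y z u →
      Runs (.loop c p) x z (s + t + u + 1)

/-- Programs are deterministic: output and number of steps are determined by the input. -/
theorem Prog.Runs.deterministic {p : Prog} {x y : Data} {t : ℕ} (h : Prog.Runs p x y t) :
    ∀ {y' : Data} {t' : ℕ}, Prog.Runs p x y' t' → y = y' ∧ t = t' := by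
  induction h with
  | id x => intro y' t' h'; cases h'; exact ⟨rfl, rfl⟩
  | nil x => intro y' t' h'; cases h'; exact ⟨rfl, rfl⟩
  | hd x => intro y' t' h'; cases h'; exact ⟨rfl, rfl⟩
  | tl x => intro y' t' h'; cases h'; exact ⟨rfl, rfl⟩
  | cons _ _ ih₁ ih₂ =>
    intro y' t' h'
    cases h' with
    | cons h₁ h₂ =>
      obtain ⟨rfl, rfl⟩ := ih₁ h₁
      obtain ⟨rfl, rfl⟩ := ih₂ h₂
      exact ⟨rfl, rfl⟩
  | seq _ _ ih₁ ih₂ =>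
    intro y' t' h'
    cases h' with
    | seq h₁ h₂ =>
      obtain ⟨rfl, rfl⟩ := ih₁ h₁
      obtain ⟨rfl, rfl⟩ := ih₂ h₂
      exact ⟨rfl, rfl⟩
  | iteTrue _ _ ih₁ ih₂ =>
    intro y' t' h'
    cases h' with
    | iteTrue h₁ h₂ =>
      obtain ⟨_, rfl⟩ := ih₁ h₁
      obtain ⟨rfl, rfl⟩ := ih₂ h₂
      exact ⟨rfl, rfl⟩
    | iteFalse h₁ h₂ => exact absurd (ih₁ h₁).1 (by simp)
  | iteFalse _ _ ih₁ ih₂ =>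
    intro y' t' h'
    cases h' with
    | iteTrue h₁ h₂ => exact absurd (ih₁ h₁).1 (by simp)
    | iteFalse h₁ h₂ =>
      obtain ⟨_, rfl⟩ := ih₁ h₁
      obtain ⟨rfl, rfl⟩ := ih₂ h₂
      exact ⟨rfl, rfl⟩
  | loopStop _ ih₁ =>
    intro y' t' h'
    cases h' with
    | loopStop h₁ =>
      obtain ⟨_, rfl⟩ := ih₁ h₁
      exact ⟨rfl, rfl⟩
    | loopStep h₁ _ _ => exact absurd (ih₁ h₁).1 (by simp)
  | loopStep _ _ _ ih₁ ih₂ ih₃ =>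
    intro y' t' h'
    cases h' with
    | loopStop h₁ => exact absurd (ih₁ h₁).1 (by simp)
    | loopStep h₁ h₂ h₃ =>
      obtain ⟨_, rfl⟩ := ih₁ h₁
      obtain ⟨rfl, rfl⟩ := ih₂ h₂
      obtain ⟨rfl, rfl⟩ := ih₃ h₃
      exact ⟨rfl, rfl⟩

/-- The problem "given an input `a` with `dom a`, decide whether `yes a`" is solved in
polynomial time by the program `p`: on every input `a` with `dom a`, encoded as the tree `enc a`,
`p` halts within a number of steps polynomial in the size of `enc a`, and accepts (returns a tree
other than the leaf) if and only if `yes a`. Nothing is required on inputs outside `dom`. -/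
def Prog.SolvesInPolyTime {α : Type} (p : Prog) (enc : α → Data) (dom yes : α → Prop) : Prop :=
  ∃ q : Polynomial ℕ, ∀ a : α, dom a →
    ∃ (y : Data) (t : ℕ), p.Runs (enc a) y t ∧ t ≤ q.eval (enc a).size ∧ (y ≠ .nil ↔ yes a)

/-! ### Relations, constraint languages, polymorphisms -/

/-- A constraint language over `D`: a set of relations over `D`, each with its arity. -/
abbrev ConstraintLanguage (D : Type) : Type := Set (Σ r : ℕ, Set (Fin r → D))

/-- The conservative extension: add all unary relations over `D`. -/
def ConstraintLanguage.conservativeExtension {D : Type} (Γ : ConstraintLanguage D) :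
    ConstraintLanguage D :=
  Γ ∪ {R | R.1 = 1}

/-- The `k`-ary operation `f` on `D` is a polymorphism of `Γ`. -/
def IsPolymorphism {D : Type} {k : ℕ} (f : (Fin k → D) → D) (Γ : ConstraintLanguage D) : Prop :=
  ∀ R ∈ Γ, ∀ t : Fin k → Fin R.1 → D, (∀ i, t i ∈ R.2) → (fun j => f (fun i => t i j)) ∈ R.2

/-! ### Linear strong Mal'tsev conditions -/

/-- Linear identities over operation symbols `0, …, m - 1` of the given arities; the variables
are named by natural numbers. -/
inductive LinearIdentity {m : ℕ} (arity : Fin m → ℕ) : Type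
  /-- the identity `fᵢ(x₁, …, xₖ) ≈ fⱼ(y₁, …, y_c)` -/
  | opOp (i j : Fin m) (x : Fin (arity i) → ℕ) (y : Fin (arity j) → ℕ) : LinearIdentity arity
  /-- the identity `fᵢ(x₁, …, xₖ) ≈ y` -/
  | opVar (i : Fin m) (x : Fin (arity i) → ℕ) (y : ℕ) : LinearIdentity arity

/-- A linear strong Mal'tsev condition: a finite set of linear identities over finitely many
operation symbols. -/
structure LinearMaltsevCondition : Type where
  /-- number of operation symbols -/
  numSymbols : ℕ
  /-- arities of the operation symbols -/
  arity : Fin numSymbols → ℕ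
  /-- the identities -/
  identities : Finset (LinearIdentity arity)

/-- An operation on `D` of the right arity for every operation symbol of `M`. -/
abbrev LinearMaltsevCondition.Interpretation (M : LinearMaltsevCondition) (D : Type) : Type :=
  ∀ i : Fin M.numSymbols, (Fin (M.arity i) → D) → D

/-- The operations `F` satisfy the given identity: it holds for all assignments to its
variables. -/
def LinearIdentity.Holds {m : ℕ} {arity : Fin m → ℕ} {D : Type}
    (F : ∀ i : Fin m, (Fin (arity i) → D) → D) : LinearIdentity arity → Prop
  | .opOp i j x y => ∀ φ : ℕ → D, F i (fun a => φ (x a)) = F j (fun b => φ (y b))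
  | .opVar i x y => ∀ φ : ℕ → D, F i (fun a => φ (x a)) = φ y

/-- The operations `F` are polymorphisms of `Γ` that satisfy `M`. -/
def LinearMaltsevCondition.ArePolymorphismsSatisfying (M : LinearMaltsevCondition) {D : Type}
    (F : M.Interpretation D) (Γ : ConstraintLanguage D) : Prop :=
  (∀ i, IsPolymorphism (F i) Γ) ∧ ∀ e ∈ M.identities, e.Holds F

/-- The language `Γ` satisfies `M`: it has polymorphisms that satisfy `M`. -/
def ConstraintLanguage.Satisfies {D : Type} (Γ : ConstraintLanguage D)
    (M : LinearMaltsevCondition) : Prop :=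
  ∃ F : M.Interpretation D, M.ArePolymorphismsSatisfying F Γ

/-! ### CSP instances -/

/-- A constraint over `n` variables and a domain with `d` values: a scope and a relation, the
latter given as an explicit list of tuples. -/
structure Constraint (n d : ℕ) : Type where
  /-- arity of the constraint -/
  arity : ℕ
  /-- the scope -/
  scope : Fin arity → Fin n
  /-- the tuples of the relation -/
  tuples : List (Fin arity → Fin d)

/-- A CSP instance with variables `0, …, numVars - 1` and domain `{0, …, domSize - 1}`. -/
structure Instance : Type where
  /-- number of variables -/
  numVars : ℕ
  /-- number of values -/
  domSize : ℕ
  /-- the constraints -/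
  constraints : List (Constraint numVars domSize)

/-- The relation of a constraint. -/
def Constraint.relation {n d : ℕ} (C : Constraint n d) : Σ r : ℕ, Set (Fin r → Fin d) :=
  ⟨C.arity, {t | t ∈ C.tuples}⟩

/-- The constraint language of an instance. -/
def Instance.language (I : Instance) : ConstraintLanguage (Fin I.domSize) :=
  {R | ∃ C ∈ I.constraints, C.relation = R}

/-- The instance has a satisfying assignment. -/
def Instance.IsSatisfiable (I : Instance) : Prop :=
  ∃ φ : Fin I.numVars → Fin I.domSize,
    ∀ C ∈ I.constraints, (fun j => φ (C.scope j)) ∈ C.tuples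

/-! ### Encodings of inputs

Numbers are written in unary. As the variables and the values of an instance are listed
explicitly, this changes the size of an input at most polynomially. -/

/-- Encoding of a tuple over `{0, …, d - 1}`. -/
def encodeTuple {k d : ℕ} (t : Fin k → Fin d) : Data :=
  Data.ofList (List.ofFn fun i => Data.ofNat (t i))

/-- A constraint is encoded by its scope and the list of its tuples. -/
def Constraint.encode {n d : ℕ} (C : Constraint n d) : Data :=
  .cons (encodeTuple C.scope) (Data.ofList (C.tuples.map encodeTuple))

/-- An instance is encoded by its number of variables, its number of values and the list of
its constraints. -/
def Instance.encode (I : Instance) : Data :=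
  .cons (Data.ofNat I.numVars) (.cons (Data.ofNat I.domSize)
    (Data.ofList (I.constraints.map Constraint.encode)))

/-- All `k`-tuples over `{0, …, d - 1}`, in lexicographic order. -/
def allTuples (d : ℕ) : (k : ℕ) → List (Fin k → Fin d)
  | 0 => [Fin.elim0]
  | k + 1 => (List.finRange d).flatMap fun v =>
      (allTuples d k).map fun t => (Fin.cons v t : Fin (k + 1) → Fin d)

/-- A `k`-ary operation is encoded by its full table: all pairs of an argument tuple and the
value there. -/
def encodeOperation {k d : ℕ} (f : (Fin k → Fin d) → Fin d) : Data :=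
  Data.ofList ((allTuples d k).map fun t => .cons (encodeTuple t) (Data.ofNat (f t)))

/-- An instance paired with an operation on its domain for every symbol of `M`. -/
abbrev LinearMaltsevCondition.PairedInstance (M : LinearMaltsevCondition) : Type :=
  Σ I : Instance, M.Interpretation (Fin I.domSize)

/-- Encoding of an instance paired with operations. -/
def LinearMaltsevCondition.encodePaired (M : LinearMaltsevCondition) (P : M.PairedInstance) :
    Data :=
  .cons P.1.encode (Data.ofList (List.ofFn fun i => encodeOperation (P.2 i)))

/-! ### Uniform and semiuniform algorithms for conservative languages -/

/-- `M` has a uniform polynomial-time algorithm for conservative languages: one algorithm that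
solves, in polynomial time, all instances `I` such that the conservative extension of the language
of `I` satisfies `M`. -/
def LinearMaltsevCondition.HasUniformAlgorithmForConservative (M : LinearMaltsevCondition) :
    Prop :=
  ∃ p : Prog, p.SolvesInPolyTime Instance.encode
    (fun I => I.language.conservativeExtension.Satisfies M)
    (fun I => I.IsSatisfiable)

/-- `M` has a semiuniform polynomial-time algorithm for conservative languages: one algorithm
that solves, in polynomial time, all instances `I` that are paired with polymorphisms of the
conservative extension of the language of `I` (that is, with conservative polymorphisms of the
language of `I`) that satisfy `M`. -/
def LinearMaltsevCondition.HasSemiuniformAlgorithmForConservative (M : LinearMaltsevCondition) :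
    Prop :=
  ∃ p : Prog, p.SolvesInPolyTime M.encodePaired
    (fun P => M.ArePolymorphismsSatisfying P.2 P.1.language.conservativeExtension)
    (fun P => P.1.IsSatisfiable)

end ConsCSP

/-! It suffices to find, in polynomial time, conservative polymorphisms of the instance that satisfy
`M`; the semiuniform algorithm then decides satisfiability. Such polymorphisms are the solutions of
an indicator problem: it has a variable `i :: x` for every symbol `i` and argument tuple `x`, and
its constraints express preservation of the relations and the identities of `M`. This problem is
solved in stages. Each stage hands the operations found so far to the semiuniform algorithm in order
to find more of them.

A state consists of a list `Ss` of sets and a table satisfying all indicator constraints whose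
variables are covered, that is, have their argument tuple inside some member of `Ss`. At the start
`Ss` holds the singletons, where conservativity leaves no choice. A new set `s` has at most as many
elements as the largest arity, so there are boundedly many guesses (`patterns`) for the operations
on `s`. After a guess, every variable that still matters has a domain inside a member of the old
`Ss`. On each such domain the table is conservative and satisfies `M`, and it preserves the
constraints between these domains. Hence the semiuniform algorithm can decide whether a guess
extends to a solution, and fixing variables one at a time produces one (`foldl_narrow_spec`). Some
guess succeeds because actual polymorphisms exist (`exists_solvable_startDomains`). Once all
argument tuples have been added, everything is covered and the table is the desired one
(`conservativePolymorphisms_finalTable`).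

The semiuniform algorithm expects operations on a single domain, whereas the table acts separately
on the domain of each variable. The domains are therefore made disjoint (`taggedInstance`) and the
operations are glued by `mix`. Fix conservative operations `b` on two values satisfying `M`.
Thresholds extend `b` to any linear order (`chain`), which picks one argument and thereby a domain.
Arguments from other domains are replaced by a common value `c` of that domain and the table is
applied; the result counts only if it does not depend on `c`, and otherwise the picked argument is
returned. This is conservative (`mix_mem`), agrees with the table on each single domain
(`mix_column`), and satisfies `M` because linear identities involve no composition
(`conservativePolymorphisms_mix`). If no such `b` exists, then conservative operations satisfying
`M` exist only over at most one value, and satisfiability is trivial to decide.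

The operations are guaranteed to be polymorphisms only along the actual run, so running times are
proved under a promise (`PolyTimeOn`), and each fold carries an invariant and a size bound
(`PolyTimeOn.foldl`). -/

namespace ConsCSP

/-! ### Polynomial-time functions between encoded types -/

/-- Types whose elements are encoded as trees. -/
class Enc (α : Type) where
  /-- the encoding -/
  enc : α → Data


namespace Data

theorem size_pos (x : Data) : 0 < x.size := by cases x <;> simp [size]

theorem size_hd_le (x : Data) : x.hd.size ≤ x.size := by
  cases x <;> simp only [hd, size] <;> omega

theorem size_tl_le (x : Data) : x.tl.size ≤ x.size := by
  cases x <;> simp only [tl, size] <;> omega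

end Data

instance : Enc Unit := ⟨fun _ => .nil⟩
instance : Enc ℕ := ⟨Data.ofNat⟩
instance : Enc Bool := ⟨fun b => bif b then .cons .nil .nil else .nil⟩
instance {α β : Type} [Enc α] [Enc β] : Enc (α × β) := ⟨fun x => .cons (Enc.enc x.1) (Enc.enc x.2)⟩
instance {α : Type} [Enc α] : Enc (List α) := ⟨fun l => Data.ofList (l.map Enc.enc)⟩

/-- The size of the encoding. -/
def esize {α : Type} [Enc α] (a : α) : ℕ := (Enc.enc a).size

section

variable {α β γ δ : Type} [Enc α] [Enc β] [Enc γ] [Enc δ]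

theorem esize_pos (a : α) : 0 < esize a := Data.size_pos _

@[simp] theorem esize_pair (a : α) (b : β) : esize (a, b) = esize a + esize b + 1 := rfl

@[simp] theorem esize_list_nil : esize ([] : List α) = 1 := rfl

@[simp] theorem esize_list_cons (a : α) (l : List α) :
    esize (a :: l) = esize a + esize l + 1 := rfl

theorem esize_nat (n : ℕ) : esize n = 2 * n + 1 := by
  induction n with
  | zero => rfl
  | succ n ih =>
    change 1 + esize n + 1 = _
    omega

theorem esize_bool_le (b : Bool) : esize b ≤ 3 := by cases b <;> decide

theorem esize_append (l₁ l₂ : List α) : esize (l₁ ++ l₂) + 1 = esize l₁ + esize l₂ := by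
  induction l₁ with
  | nil => simp; omega
  | cons a l ih => simp only [List.cons_append, esize_list_cons]; omega

theorem esize_le_of_mem {a : α} {l : List α} (h : a ∈ l) : esize a ≤ esize l := by
  induction l with
  | nil => simp at h
  | cons b l ih =>
    rcases List.mem_cons.1 h with rfl | h
    · simp; omega
    · have := ih h; simp; omega

theorem length_le_esize (l : List α) : l.length ≤ esize l := by
  induction l with
  | nil => simp
  | cons b l ih => simp; omega

theorem esize_list_le {l : List α} {B L : ℕ} (hl : l.length ≤ L) (h : ∀ a ∈ l, esize a ≤ B) :
    esize l ≤ L * (B + 1) + 1 := by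
  have : esize l ≤ l.length * (B + 1) + 1 := by
    clear hl
    induction l with
    | nil => simp
    | cons b l ih =>
      have h1 := ih fun a ha => h a (List.mem_cons_of_mem _ ha)
      have h2 := h b (by simp)
      simp only [esize_list_cons, List.length_cons]
      ring_nf at h1 ⊢
      omega
  exact this.trans (by gcongr)

theorem esize_le_of_sublist {l₁ l₂ : List α} (h : l₁.Sublist l₂) : esize l₁ ≤ esize l₂ := by
  induction h with
  | slnil => rfl
  | cons a _ ih => simp; omega
  | cons_cons a _ ih => simp; omega

theorem polynomial_eval_mono (q : Polynomial ℕ) {m n : ℕ} (h : m ≤ n) : q.eval m ≤ q.eval n := by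
  induction q using Polynomial.induction_on' with
  | add p q hp hq => simp only [Polynomial.eval_add]; omega
  | monomial k a => simp only [Polynomial.eval_monomial]; gcongr

/-- The function `b` is bounded on `P` by a polynomial in the size of its argument. -/
def PolyBoundedOn (P : α → Prop) (b : α → ℕ) : Prop :=
  ∃ q : Polynomial ℕ, ∀ a, P a → b a ≤ q.eval (esize a)

namespace PolyBoundedOn

variable {P : α → Prop} {b c : α → ℕ}

theorem of_le (hc : PolyBoundedOn P c) (h : ∀ a, P a → b a ≤ c a) : PolyBoundedOn P b := by
  obtain ⟨q, hq⟩ := hc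
  exact ⟨q, fun a ha => (h a ha).trans (hq a ha)⟩

theorem mono {Q : α → Prop} (hc : PolyBoundedOn Q c) (h : ∀ a, P a → Q a) :
    PolyBoundedOn P c := by
  obtain ⟨q, hq⟩ := hc
  exact ⟨q, fun a ha => hq a (h a ha)⟩

theorem const (n : ℕ) : PolyBoundedOn P fun _ => n := ⟨.C n, fun _ _ => by simp⟩

theorem size : PolyBoundedOn P fun a => esize a := ⟨.X, fun _ _ => by simp⟩

theorem add (hb : PolyBoundedOn P b) (hc : PolyBoundedOn P c) :
    PolyBoundedOn P fun a => b a + c a := by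
  obtain ⟨q, hq⟩ := hb
  obtain ⟨r, hr⟩ := hc
  exact ⟨q + r, fun a ha => by simpa using Nat.add_le_add (hq a ha) (hr a ha)⟩

theorem mul (hb : PolyBoundedOn P b) (hc : PolyBoundedOn P c) :
    PolyBoundedOn P fun a => b a * c a := by
  obtain ⟨q, hq⟩ := hb
  obtain ⟨r, hr⟩ := hc
  exact ⟨q * r, fun a ha => by simpa using Nat.mul_le_mul (hq a ha) (hr a ha)⟩

theorem comp {P : α → Prop} {Q : β → Prop} {b : β → ℕ} {f : α → β} (hb : PolyBoundedOn Q b)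
    (hf : PolyBoundedOn P fun a => esize (f a)) (h : ∀ a, P a → Q (f a)) :
    PolyBoundedOn P fun a => b (f a) := by
  obtain ⟨q, hq⟩ := hb
  obtain ⟨r, hr⟩ := hf
  refine ⟨q.comp r, fun a ha => (hq _ (h a ha)).trans ?_⟩
  rw [Polynomial.eval_comp]
  exact polynomial_eval_mono q (hr a ha)

end PolyBoundedOn

/-- On inputs with property `P`, the function `f` is computed by a program within time polynomial
in the size of the input, and the size of the result is polynomial in the size of the input. -/
def PolyTimeOn (P : α → Prop) (f : α → β) : Prop :=
  ∃ (p : Prog) (T : α → ℕ), PolyBoundedOn P T ∧ (PolyBoundedOn P fun a => esize (f a)) ∧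
    ∀ a, P a → ∃ t ≤ T a, p.Runs (Enc.enc a) (Enc.enc (f a)) t

/-- Functions that are computable in polynomial time on all inputs. -/
@[fun_prop]
def PolyTime (f : α → β) : Prop := PolyTimeOn (fun _ => True) f

/-! ### Closure properties of polynomial-time computability under a promise. -/

namespace PolyTimeOn

variable {P : α → Prop} {Q : β → Prop}

theorem bounded {f : α → β} (hf : PolyTimeOn P f) : PolyBoundedOn P fun a => esize (f a) := by
  obtain ⟨_, _, _, h, _⟩ := hf
  exact h

theorem mono {P' : α → Prop} {f : α → β} (hf : PolyTimeOn P' f) (h : ∀ a, P a → P' a) :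
    PolyTimeOn P f := by
  obtain ⟨p, T, h1, h2, h3⟩ := hf
  exact ⟨p, T, h1.mono h, h2.mono h, fun a ha => h3 a (h a ha)⟩

theorem congr {f g : α → β} (hf : PolyTimeOn P f) (h : ∀ a, P a → f a = g a) :
    PolyTimeOn P g := by
  obtain ⟨p, T, h1, h2, h3⟩ := hf
  exact ⟨p, T, h1, h2.of_le fun a ha => by rw [h a ha], fun a ha => h a ha ▸ h3 a ha⟩

theorem of_enc_eq {f : α → β} {g : α → γ} (hf : PolyTimeOn P f)
    (h : ∀ a, P a → Enc.enc (g a) = Enc.enc (f a)) : PolyTimeOn P g := by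
  obtain ⟨p, T, h1, h2, h3⟩ := hf
  refine ⟨p, T, h1, h2.of_le fun a ha => ?_, fun a ha => ?_⟩
  · simp [esize, h a ha]
  · rw [h a ha]; exact h3 a ha

theorem id : PolyTimeOn P fun a => a :=
  ⟨.id, fun _ => 1, .const 1, .size, fun _ _ => ⟨1, le_rfl, .id _⟩⟩

/-- The second program runs in time polynomial in the size of `f a`, which a step count for the
first would not control: `cons id id` doubles a tree in three steps. This is why `PolyTimeOn` also
bounds the size of the output. -/
theorem comp {g : β → γ} {f : α → β} (hg : PolyTimeOn Q g) (hf : PolyTimeOn P f)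
    (h : ∀ a, P a → Q (f a)) : PolyTimeOn P fun a => g (f a) := by
  obtain ⟨p, T, h1, h2, h3⟩ := hf
  obtain ⟨q, U, k1, k2, k3⟩ := hg
  refine ⟨.seq p q, fun a => T a + U (f a) + 1, (h1.add (k1.comp h2 h)).add (.const 1),
    k2.comp h2 h, fun a ha => ?_⟩
  obtain ⟨s, hs, r⟩ := h3 a ha
  obtain ⟨t, ht, r'⟩ := k3 _ (h a ha)
  exact ⟨s + t + 1, by beta_reduce; omega, .seq r r'⟩

theorem pair {f : α → β} {g : α → γ} (hf : PolyTimeOn P f) (hg : PolyTimeOn P g) :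
    PolyTimeOn P fun a => (f a, g a) := by
  obtain ⟨p, T, h1, h2, h3⟩ := hf
  obtain ⟨q, U, k1, k2, k3⟩ := hg
  refine ⟨.cons p q, fun a => T a + U a + 1, (h1.add k1).add (.const 1),
    (h2.add k2).add (.const 1), fun a ha => ?_⟩
  obtain ⟨s, hs, r⟩ := h3 a ha
  obtain ⟨t, ht, r'⟩ := k3 a ha
  exact ⟨s + t + 1, by beta_reduce; omega, .cons r r'⟩

theorem ite {c : α → Bool} {f g : α → β} (hc : PolyTimeOn P c) (hf : PolyTimeOn P f)
    (hg : PolyTimeOn P g) : PolyTimeOn P fun a => bif c a then f a else g a := by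
  obtain ⟨o, S, l1, l2, l3⟩ := hc
  obtain ⟨p, T, h1, h2, h3⟩ := hf
  obtain ⟨q, U, k1, k2, k3⟩ := hg
  refine ⟨.ite o p q, fun a => S a + T a + U a + 1, ((l1.add h1).add k1).add (.const 1),
    (h2.add k2).of_le fun a ha => ?_, fun a ha => ?_⟩
  · beta_reduce; cases c a <;> simp only [cond_true, cond_false] <;> omega
  · obtain ⟨s, hs, r⟩ := l3 a ha
    obtain ⟨t, ht, r'⟩ := h3 a ha
    obtain ⟨u, hu, r''⟩ := k3 a ha
    beta_reduce
    cases hca : c a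
    · rw [hca] at r
      exact ⟨s + u + 1, by omega, .iteFalse r r''⟩
    · rw [hca] at r
      exact ⟨s + t + 1, by omega, .iteTrue r r'⟩

end PolyTimeOn

/-! ### Basic functions that are polynomial-time on all inputs. -/

namespace PolyTime

theorem on {f : α → β} (hf : PolyTime f) (P : α → Prop) : PolyTimeOn P f :=
  PolyTimeOn.mono hf fun _ _ => trivial

@[fun_prop]
theorem id : PolyTime fun a : α => a := PolyTimeOn.id

@[fun_prop]
theorem comp {g : β → γ} {f : α → β} (hg : PolyTime g) (hf : PolyTime f) :
    PolyTime fun a => g (f a) :=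
  PolyTimeOn.comp hg hf fun _ _ => trivial

@[fun_prop]
theorem pair {f : α → β} {g : α → γ} (hf : PolyTime f) (hg : PolyTime g) :
    PolyTime fun a => (f a, g a) := PolyTimeOn.pair hf hg

@[fun_prop]
theorem cond {c : α → Bool} {f g : α → β} (hc : PolyTime c) (hf : PolyTime f)
    (hg : PolyTime g) : PolyTime fun a => bif c a then f a else g a := PolyTimeOn.ite hc hf hg

theorem of_enc_eq {f : α → β} {g : α → γ} (hf : PolyTime f)
    (h : ∀ a, Enc.enc (g a) = Enc.enc (f a)) : PolyTime g :=
  PolyTimeOn.of_enc_eq hf fun a _ => h a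

@[fun_prop]
theorem const (b : β) : PolyTime fun _ : α => b := by
  suffices h : ∀ d : Data, ∃ (p : Prog) (n : ℕ), ∀ x, p.Runs x d n by
    obtain ⟨p, n, h⟩ := h (Enc.enc b)
    exact ⟨p, fun _ => n, .const n, .const _, fun a _ => ⟨n, le_rfl, h _⟩⟩
  intro d
  induction d with
  | nil => exact ⟨.nil, 1, .nil⟩
  | cons a b iha ihb =>
    obtain ⟨p, m, hp⟩ := iha
    obtain ⟨q, n, hq⟩ := ihb
    exact ⟨.cons p q, m + n + 1, fun x => .cons (hp x) (hq x)⟩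

theorem of_hd {f : α → β} (h : ∀ a, Enc.enc (f a) = (Enc.enc a).hd) : PolyTime f :=
  ⟨.hd, fun _ => 1, .const 1, PolyBoundedOn.size.of_le fun a _ => by
    simpa only [esize, h] using Data.size_hd_le _, fun a _ => ⟨1, le_rfl, h a ▸ .hd _⟩⟩

theorem of_tl {f : α → β} (h : ∀ a, Enc.enc (f a) = (Enc.enc a).tl) : PolyTime f :=
  ⟨.tl, fun _ => 1, .const 1, PolyBoundedOn.size.of_le fun a _ => by
    simpa only [esize, h] using Data.size_tl_le _, fun a _ => ⟨1, le_rfl, h a ▸ .tl _⟩⟩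

@[fun_prop]
theorem fst : PolyTime (Prod.fst : α × β → α) := of_hd fun _ => rfl

@[fun_prop]
theorem snd : PolyTime (Prod.snd : α × β → β) := of_tl fun _ => rfl

@[fun_prop]
theorem list_tail : PolyTime (List.tail : List α → List α) :=
  of_tl fun l => by cases l <;> rfl

@[fun_prop]
theorem list_cons {f : α → β} {g : α → List β} (hf : PolyTime f) (hg : PolyTime g) :
    PolyTime fun a => f a :: g a :=
  of_enc_eq (pair hf hg) fun _ => rfl

@[fun_prop]
theorem list_isEmpty : PolyTime (List.isEmpty : List α → Bool) := by
  refine ⟨.ite .id .nil (.cons .nil .nil), fun _ => 5, .const 5,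
    (PolyBoundedOn.const 3).of_le fun _ _ => esize_bool_le _, fun l _ => ?_⟩
  cases l with
  | nil => exact ⟨5, le_rfl, .iteFalse (.id _) (.cons (.nil _) (.nil _))⟩
  | cons a l => exact ⟨3, by beta_reduce; omega, .iteTrue (.id _) (.nil _)⟩

@[fun_prop]
theorem bool_not : PolyTime Bool.not := by
  refine ⟨.ite .id .nil (.cons .nil .nil), fun _ => 5, .const 5,
    (PolyBoundedOn.const 3).of_le fun _ _ => esize_bool_le _, fun b _ => ?_⟩
  cases b with
  | false => exact ⟨5, le_rfl, .iteFalse (.id _) (.cons (.nil _) (.nil _))⟩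
  | true => exact ⟨3, by beta_reduce; omega, .iteTrue (.id _) (.nil _)⟩

@[fun_prop]
theorem bool_and {f g : α → Bool} (hf : PolyTime f) (hg : PolyTime g) :
    PolyTime fun a => f a && g a :=
  (cond hf hg (const false)).congr fun a _ => by cases f a <;> rfl

@[fun_prop]
theorem bool_or {f g : α → Bool} (hf : PolyTime f) (hg : PolyTime g) :
    PolyTime fun a => f a || g a :=
  (cond hf (const true) hg).congr fun a _ => by cases f a <;> rfl

@[fun_prop]
theorem list_headD {f : α → List β} {g : α → β} (hf : PolyTime f) (hg : PolyTime g) :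
    PolyTime fun a => (f a).headD (g a) := by
  have : PolyTime fun x : List β × β => x.1.headD x.2 := by
    refine ⟨.ite .hd (.seq .hd .hd) .tl, fun _ => 5, .const 5,
      PolyBoundedOn.size.of_le fun x _ => ?_, fun x _ => ?_⟩
    · obtain ⟨_ | ⟨a, l⟩, b⟩ := x <;> simp <;> omega
    · obtain ⟨_ | ⟨a, l⟩, b⟩ := x
      · exact ⟨3, by beta_reduce; omega, .iteFalse (.hd _) (.tl _)⟩
      · exact ⟨5, le_rfl, .iteTrue (.hd _) (.seq (.hd _) (.hd _))⟩
  exact comp this (pair hf hg)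

end PolyTime

/-! ### Folds -/

/-- Iterating a polynomial-time step can make the accumulator grow exponentially, and the step need
only work where its promise holds. Hence both the promise `Q` and the bound `B` are required for the
accumulator after every prefix of the list. -/
theorem PolyTimeOn.foldl {P : α → Prop} {Q : α × γ × β → Prop} {l : α → List β} {init : α → γ}
    {step : α → γ → β → γ} (hl : PolyTimeOn P l) (hinit : PolyTimeOn P init)
    (hstep : PolyTimeOn Q fun x => step x.1 x.2.1 x.2.2)
    (hQ : ∀ a, P a → ∀ l₁ b l₂, l a = l₁ ++ b :: l₂ →
      Q (a, l₁.foldl (step a) (init a), b))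
    {B : α → ℕ} (hB : PolyBoundedOn P B)
    (hsize : ∀ a, P a → ∀ l₁ l₂, l a = l₁ ++ l₂ → esize (l₁.foldl (step a) (init a)) ≤ B a) :
    PolyTimeOn P fun a => (l a).foldl (step a) (init a) := by
  obtain ⟨pl, Tl, h1, h2, h3⟩ := hl
  obtain ⟨pi, Ti, k1, k2, k3⟩ := hinit
  obtain ⟨ps, Ts, ⟨q, hq⟩, -, s3⟩ := hstep
  -- The loop state is the triple of remaining list, parameter and accumulator. From `(b :: l₂, a,
  -- c)`, `arg` assembles the input `(a, c, b)` of the step, and `body` produces `(l₂, a, step a c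
  -- b)`. The loop condition `hd` fails exactly when the list is used up.
  let arg : Prog := .cons (.seq .tl .hd) (.cons (.seq .tl .tl) (.seq .hd .hd))
  let body : Prog := .cons (.seq .hd .tl) (.cons (.seq .tl .hd) (.seq arg ps))
  let U : α → ℕ := fun a => q.eval (esize a + (B a + esize (l a) + 1) + 1)
  have hU : PolyBoundedOn P U := by
    obtain ⟨r, hr⟩ := (PolyBoundedOn.size (P := P)).add ((hB.add h2).add (.const 1)) |>.add
      (.const 1)
    refine ⟨q.comp r, fun a ha => ?_⟩
    rw [Polynomial.eval_comp]
    exact polynomial_eval_mono q (hr a ha)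
  refine ⟨.seq (.seq (.cons pl (.cons .id pi)) (.loop .hd body)) (.seq .tl .tl),
    fun a => Tl a + Ti a + esize (l a) * (U a + 40) + 40, ?_, hB.of_le ?_, fun a ha => ?_⟩
  · exact ((h1.add k1).add (h2.mul (hU.add (.const 40)))).add (.const 40)
  · exact fun a ha => hsize a ha (l a) [] (by simp)
  have loop : ∀ (l₂ l₁ : List β), l a = l₁ ++ l₂ → ∃ t ≤ l₂.length * (U a + 30) + 30,
      (Prog.loop .hd body).Runs (Enc.enc (l₂, a, l₁.foldl (step a) (init a)))
        (Enc.enc (([] : List β), a, (l a).foldl (step a) (init a))) t := by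
    intro l₂
    induction l₂ with
    | nil =>
      intro l₁ h
      rw [List.append_nil] at h
      subst h
      exact ⟨2, by omega, .loopStop (.hd _)⟩
    | cons b l₂ ih =>
      intro l₁ h
      obtain ⟨t, ht, r⟩ := ih (l₁ ++ [b]) (by simp [h])
      obtain ⟨s, hs, r'⟩ := s3 _ (hQ a ha l₁ b l₂ h)
      have hs' : s ≤ U a := by
        refine hs.trans ((hq _ (hQ a ha l₁ b l₂ h)).trans (polynomial_eval_mono q ?_))
        have := hsize a ha l₁ _ h
        have : esize b ≤ esize (l a) := esize_le_of_mem (by simp [h])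
        simp only [esize_pair]
        omega
      rw [List.foldl_append] at r
      have rb : body.Runs (Enc.enc (b :: l₂, a, l₁.foldl (step a) (init a)))
          (Enc.enc (l₂, a, step a (l₁.foldl (step a) (init a)) b)) _ :=
        .cons (.seq (.hd _) (.tl _)) (.cons (.seq (.tl _) (.hd _))
          (.seq (.cons (.seq (.tl _) (.hd _))
            (.cons (.seq (.tl _) (.tl _)) (.seq (.hd _) (.hd _)))) r'))
      refine ⟨_, ?_, .loopStep (.hd _) rb r⟩
      simp only [List.length_cons]
      ring_nf at ht ⊢
      omega
  obtain ⟨t, ht, r⟩ := loop (l a) [] rfl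
  obtain ⟨s, hs, r'⟩ := h3 a ha
  obtain ⟨u, hu, r''⟩ := k3 a ha
  refine ⟨_, ?_, .seq (.seq (.cons r' (.cons (.id _) r'')) r) (.seq (.tl _) (.tl _))⟩
  have h5 := length_le_esize (l a)
  have h6 : (l a).length * (U a + 30) ≤ esize (l a) * (U a + 40) := by gcongr; omega
  beta_reduce
  omega

end

/-- Removing duplicates. -/
def nub {β : Type} [BEq β] (l : List β) : List β :=
  l.foldr (fun a l => bif l.contains a then l else a :: l) []

theorem nub_sublist {β : Type} [BEq β] (l : List β) : (nub l).Sublist l := by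
  induction l with
  | nil => exact .slnil
  | cons a l ih =>
    change (bif (nub l).contains a then nub l else a :: nub l).Sublist _
    cases (nub l).contains a
    · exact ih.cons_cons a
    · exact ih.cons a

/-! ### Polynomial-time list operations. -/

section

variable {α β γ δ : Type} [Enc α] [Enc β] [Enc γ] [Enc δ]

theorem esize_list_eq_sum (l : List α) : esize l = (l.map fun a => esize a + 1).sum + 1 := by
  induction l with
  | nil => rfl
  | cons a l ih => simp only [esize_list_cons, ih, List.map_cons, List.sum_cons]; omega

theorem esize_eq_of_perm {l₁ l₂ : List α} (h : l₁.Perm l₂) : esize l₁ = esize l₂ := by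
  simp only [esize_list_eq_sum, (h.map _).sum_eq]

@[simp] theorem esize_reverse (l : List α) : esize l.reverse = esize l :=
  esize_eq_of_perm l.reverse_perm

theorem esize_append_le (l₁ l₂ : List α) : esize (l₁ ++ l₂) ≤ esize l₁ + esize l₂ := by
  have := esize_append l₁ l₂
  omega

namespace PolyTime

@[fun_prop]
theorem list_reverse : PolyTime (List.reverse : List α → List α) := by
  have h : PolyTimeOn (fun _ : List α => True)
      fun a => a.foldl (fun l b => b :: l) ([] : List α) := by
    refine PolyTimeOn.foldl (Q := fun _ => True) (step := fun _ l b => b :: l)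
      (init := fun _ => []) (l := fun a => a) (id.on _) ((const _).on _)
      (PolyTime.on (by fun_prop) _) (by simp) (B := fun a => esize a) PolyBoundedOn.size ?_
    rintro a - l₁ l₂ rfl
    have := esize_append l₁ l₂
    have := esize_pos l₂
    simp
    omega
  exact h.congr fun a _ => by simp

end PolyTime

theorem PolyTimeOn.list_foldr {P : α → Prop} {Q : α × β × γ → Prop} {l : α → List β}
    {init : α → γ} {step : α → β → γ → γ} (hl : PolyTimeOn P l) (hinit : PolyTimeOn P init)
    (hstep : PolyTimeOn Q fun x => step x.1 x.2.1 x.2.2)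
    (hQ : ∀ a, P a → ∀ l₁ b l₂, l a = l₁ ++ b :: l₂ →
      Q (a, b, l₂.foldr (step a) (init a)))
    {B : α → ℕ} (hB : PolyBoundedOn P B)
    (hsize : ∀ a, P a → ∀ l₁ l₂, l a = l₁ ++ l₂ → esize (l₂.foldr (step a) (init a)) ≤ B a) :
    PolyTimeOn P fun a => (l a).foldr (step a) (init a) := by
  have h := PolyTimeOn.foldl (P := P) (l := fun a => (l a).reverse) (init := init)
    (step := fun a c b => step a b c) (Q := fun x => Q (x.1, x.2.2, x.2.1))
    ((PolyTime.list_reverse.on fun _ => True).comp hl fun _ _ => trivial) hinit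
    (hstep.comp (f := fun x : α × γ × β => (x.1, x.2.2, x.2.1))
      (PolyTime.on (by fun_prop) _) fun _ h => h) ?_ hB ?_
  · exact h.congr fun a _ => List.foldl_reverse
  · intro a ha l₁ b l₂ h
    have := hQ a ha l₂.reverse b l₁.reverse (by simpa using congrArg List.reverse h)
    simpa [List.foldr_reverse] using this
  · intro a ha l₁ l₂ h
    have := hsize a ha l₂.reverse l₁.reverse (by simpa using congrArg List.reverse h)
    simpa [List.foldr_reverse] using this

theorem PolyTimeOn.list_map {P : α → Prop} {Q : α × β → Prop} {f : α → β → γ} {l : α → List β}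
    (hf : PolyTimeOn Q fun x => f x.1 x.2) (hl : PolyTimeOn P l)
    (hQ : ∀ a, P a → ∀ b ∈ l a, Q (a, b)) : PolyTimeOn P fun a => (l a).map (f a) := by
  obtain ⟨q, hq⟩ := hf.bounded
  have hB : PolyBoundedOn P fun a =>
      esize (l a) * (q.eval (esize a + esize (l a) + 1) + 1) + 1 := by
    obtain ⟨r, hr⟩ := (PolyBoundedOn.size.add hl.bounded).add (.const 1)
    have : PolyBoundedOn P fun a => q.eval (esize a + esize (l a) + 1) := ⟨q.comp r, fun a ha => by
      rw [Polynomial.eval_comp]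
      exact polynomial_eval_mono q (hr a ha)⟩
    exact (hl.bounded.mul (this.add (.const 1))).add (.const 1)
  have h := PolyTimeOn.list_foldr (P := P) (l := l) (init := fun _ => ([] : List γ))
    (step := fun a b c => f a b :: c) (Q := fun x => Q (x.1, x.2.1)) hl
    ((PolyTime.const _).on _) ?_ ?_ hB ?_
  · exact h.congr fun a _ => by simp [List.foldr_cons_eq_append]
  · have h1 : PolyTimeOn (fun x : α × β × List γ => Q (x.1, x.2.1)) fun x => f x.1 x.2.1 :=
      hf.comp (f := fun x : α × β × List γ => (x.1, x.2.1)) (PolyTime.on (by fun_prop) _)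
        fun _ h => h
    have h2 : PolyTimeOn (fun x : α × β × List γ => Q (x.1, x.2.1)) fun x => x.2.2 :=
      PolyTime.on (by fun_prop) _
    exact (h1.pair h2).of_enc_eq fun _ _ => rfl
  · intro a ha l₁ b l₂ h
    exact hQ a ha b (by simp [h])
  · intro a ha l₁ l₂ h
    rw [List.foldr_cons_eq_append, List.append_nil]
    refine esize_list_le ?_ ?_
    · have := length_le_esize (l a)
      rw [h, List.length_append] at this
      rw [List.length_map, h]
      omega
    · intro c hc
      obtain ⟨b, hb, rfl⟩ := List.mem_map.1 hc
      have hb' : b ∈ l a := by simp [h, hb]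
      refine (hq _ (hQ a ha b hb')).trans (polynomial_eval_mono q ?_)
      have := esize_le_of_mem hb'
      simp
      omega

namespace PolyTime

@[fun_prop]
theorem list_map {f : α → β → γ} {l : α → List β}
    (hf : PolyTime fun x : α × β => f x.1 x.2) (hl : PolyTime l) :
    PolyTime fun a => (l a).map (f a) :=
  PolyTimeOn.list_map hf hl fun _ _ _ _ => trivial

@[fun_prop]
theorem list_append {f g : α → List β} (hf : PolyTime f) (hg : PolyTime g) :
    PolyTime fun a => f a ++ g a := by
  have key : ∀ l₁ l₂ : List β, l₁.foldr (fun b c => b :: c) l₂ = l₁ ++ l₂ := by simp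
  have hB : PolyBoundedOn (fun _ : α => True) fun a => esize (f a) + esize (g a) :=
    hf.bounded.add hg.bounded
  have h := PolyTimeOn.list_foldr (P := fun _ => True) (l := f) (init := g)
    (step := fun _ b c => b :: c) (Q := fun _ => True) hf hg (PolyTime.on (by fun_prop) _)
    (by simp) hB ?_
  · exact h.congr fun a _ => by simp
  · intro a _ l₁ l₂ h
    have := esize_append l₁ l₂
    have := esize_append l₂ (g a)
    have := esize_pos l₁
    rw [key, h]
    omega

@[fun_prop]
theorem list_flatten : PolyTime (List.flatten : List (List α) → List α) := by
  have key : ∀ l : List (List α), esize l.flatten ≤ esize l := by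
    intro l
    induction l with
    | nil => simp
    | cons a l ih =>
      have := esize_append a l.flatten
      simp only [List.flatten_cons, esize_list_cons]
      omega
  have h := PolyTimeOn.list_foldr (P := fun _ => True) (l := fun l : List (List α) => l)
    (init := fun _ => ([] : List α)) (step := fun _ b c => b ++ c) (Q := fun _ => True) id
    ((const _).on _) (PolyTime.on (by fun_prop) _) (by simp)
    (B := fun a => esize a) PolyBoundedOn.size ?_
  · exact h.congr fun a _ => by rw [List.foldr_append_eq_append]; simp
  · rintro a - l₁ l₂ rfl
    have := esize_append l₁ l₂
    have := key l₂
    have := esize_pos l₁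
    have : l₂.foldr (fun b c => b ++ c) [] = l₂.flatten := by
      rw [List.foldr_append_eq_append]; simp
    rw [this]
    omega

@[fun_prop]
theorem list_flatMap {f : α → β → List γ} {l : α → List β}
    (hf : PolyTime fun x : α × β => f x.1 x.2) (hl : PolyTime l) :
    PolyTime fun a => (l a).flatMap (f a) := by
  simp only [List.flatMap_def]
  fun_prop

end PolyTime

theorem PolyTimeOn.list_filter {P : α → Prop} {Q : α × β → Prop} {f : α → β → Bool}
    {l : α → List β} (hf : PolyTimeOn Q fun x => f x.1 x.2) (hl : PolyTimeOn P l)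
    (hQ : ∀ a, P a → ∀ b ∈ l a, Q (a, b)) : PolyTimeOn P fun a => (l a).filter (f a) := by
  have h1 : PolyTimeOn P fun a => (l a).map fun b => bif f a b then [b] else [] :=
    PolyTimeOn.list_map (f := fun a b => bif f a b then [b] else [])
      (hf.ite (PolyTime.on (by fun_prop) _) (PolyTime.on (by fun_prop) _)) hl hQ
  refine ((PolyTime.list_flatten.on fun _ => True).comp h1 fun _ _ => trivial).congr ?_
  intro a _
  induction l a with
  | nil => rfl
  | cons b l ih => cases h : f a b <;> simp [h, ih]

namespace PolyTime

@[fun_prop]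
theorem list_filter {f : α → β → Bool} {l : α → List β}
    (hf : PolyTime fun x : α × β => f x.1 x.2) (hl : PolyTime l) :
    PolyTime fun a => (l a).filter (f a) :=
  PolyTimeOn.list_filter hf hl fun _ _ _ _ => trivial

@[fun_prop]
theorem list_all {f : α → β → Bool} {l : α → List β}
    (hf : PolyTime fun x : α × β => f x.1 x.2) (hl : PolyTime l) :
    PolyTime fun a => (l a).all (f a) := by
  have : PolyTime fun a => ((l a).filter fun b => (f a b).not).isEmpty := by fun_prop
  refine this.congr fun a _ => ?_
  induction l a with
  | nil => rfl
  | cons b l ih => cases h : f a b <;> simp [h, ih]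

@[fun_prop]
theorem list_any {f : α → β → Bool} {l : α → List β}
    (hf : PolyTime fun x : α × β => f x.1 x.2) (hl : PolyTime l) :
    PolyTime fun a => (l a).any (f a) := by
  have : PolyTime fun a => ((l a).filter fun b => f a b).isEmpty.not := by fun_prop
  refine this.congr fun a _ => ?_
  induction l a with
  | nil => rfl
  | cons b l ih => cases h : f a b <;> simp [h, ih]

/-! ### Natural numbers -/

/-- Since numbers are unary, they have the same code as lists of units, so arithmetic reduces to
list functions. -/
theorem enc_nat (n : ℕ) : Enc.enc n = Enc.enc (List.replicate n ()) := by
  induction n with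
  | zero => rfl
  | succ n ih =>
    change Data.cons .nil (Enc.enc n) = Data.cons .nil (Enc.enc (List.replicate n ()))
    rw [ih]

@[fun_prop]
theorem replicate_unit : PolyTime fun n : ℕ => List.replicate n () :=
  id.of_enc_eq fun n => (enc_nat n).symm

@[fun_prop]
theorem list_length : PolyTime (List.length : List α → ℕ) := by
  have h : PolyTime fun l : List α => l.map fun _ => () := by fun_prop
  refine h.of_enc_eq fun l => ?_
  rw [enc_nat, List.map_const']

@[fun_prop]
theorem nat_pred : PolyTime fun n : ℕ => n - 1 := of_tl fun n => by cases n <;> rfl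

@[fun_prop]
theorem nat_sub {f g : α → ℕ} (hf : PolyTime f) (hg : PolyTime g) :
    PolyTime fun a => f a - g a := by
  have key : ∀ (l : List Unit) (n : ℕ), l.foldl (fun n _ => n - 1) n = n - l.length := by
    intro l
    induction l with
    | nil => simp
    | cons a l ih => intro n; simp [ih]; omega
  have hl : PolyTime fun a => List.replicate (g a) () := by fun_prop
  have h := PolyTimeOn.foldl (P := fun _ => True) (l := fun a => List.replicate (g a) ())
    (init := f) (step := fun _ n _ => n - 1) (Q := fun _ => True) hl hf
    (PolyTime.on (by fun_prop) _) (by simp) hf.bounded ?_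
  · exact h.congr fun a _ => by simp [key]
  · intro a _ l₁ l₂ _
    simp only [key, esize_nat]
    omega

@[fun_prop]
theorem nat_lt {f g : α → ℕ} (hf : PolyTime f) (hg : PolyTime g) :
    PolyTime fun a => decide (f a < g a) := by
  have : PolyTime fun a => (List.replicate (g a - f a) ()).isEmpty.not := by fun_prop
  refine this.congr fun a _ => ?_
  by_cases h : f a < g a
  · have : g a - f a ≠ 0 := by omega
    simp [h, this]
  · have : g a - f a = 0 := by omega
    simp [h, this]

@[fun_prop]
theorem nat_beq {f g : α → ℕ} (hf : PolyTime f) (hg : PolyTime g) :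
    PolyTime fun a => f a == g a := by
  have : PolyTime fun a => (decide (f a < g a)).not && (decide (g a < f a)).not := by fun_prop
  refine this.congr fun a _ => ?_
  rw [Bool.eq_iff_iff]
  simp
  omega

@[fun_prop]
theorem list_range {f : α → ℕ} (hf : PolyTime f) : PolyTime fun a => List.range (f a) := by
  suffices h : PolyTime List.range from h.comp hf
  have key : ∀ l : List Unit, l.foldl (fun l _ => l ++ [l.length]) [] = List.range l.length := by
    intro l
    induction l using List.reverseRecOn with
    | nil => simp
    | append_singleton l a ih => simp [ih, List.range_succ]
  have hB : PolyBoundedOn (fun _ : ℕ => True) fun n => esize n * (esize n + 1) + 1 :=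
    (PolyBoundedOn.size.mul (PolyBoundedOn.size.add (.const 1))).add (.const 1)
  have h := PolyTimeOn.foldl (P := fun _ => True) (l := fun n => List.replicate n ())
    (init := fun _ => ([] : List ℕ)) (step := fun _ l _ => l ++ [l.length]) (Q := fun _ => True)
    (PolyTime.on (by fun_prop) _) ((const _).on _) (PolyTime.on (by fun_prop) _) (by simp) hB ?_
  · exact h.congr fun n _ => by simp [key]
  · intro n _ l₁ l₂ h
    have hn : l₁.length ≤ n := by
      have := congrArg List.length h
      simp at this
      omega
    rw [key]
    refine esize_list_le ?_ fun a ha => ?_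
    · rw [esize_nat, List.length_range]; omega
    · rw [List.mem_range] at ha
      rw [esize_nat, esize_nat]; omega

@[fun_prop]
theorem list_getD {f : α → List β} {n : α → ℕ} {g : α → β} (hf : PolyTime f) (hn : PolyTime n)
    (hg : PolyTime g) : PolyTime fun a => (f a).getD (n a) (g a) := by
  have key : ∀ (u : List Unit) (l : List β), u.foldl (fun l _ => l.tail) l = l.drop u.length := by
    intro u
    induction u with
    | nil => simp
    | cons a u ih => intro l; simp [ih]
  have hl : PolyTime fun a => List.replicate (n a) () := by fun_prop
  have h : PolyTime fun a => (f a).drop (n a) := by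
    have h := PolyTimeOn.foldl (P := fun _ => True) (l := fun a => List.replicate (n a) ())
      (init := f) (step := fun _ l _ => l.tail) (Q := fun _ => True) hl hf
      (PolyTime.on (by fun_prop) _) (by simp) hf.bounded ?_
    · exact h.congr fun a _ => by simp [key]
    · intro a _ l₁ l₂ _
      rw [key]
      exact esize_le_of_sublist (List.drop_sublist _ _)
  refine (list_headD h hg).congr fun a _ => ?_
  rw [List.headD_eq_head?_getD, List.head?_drop, List.getD_eq_getElem?_getD]

/-- Polynomial-time equality tests. -/
class PolyTimeEq (α : Type) [Enc α] [BEq α] : Prop where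
  beq : PolyTime fun x : α × α => x.1 == x.2

@[fun_prop]
theorem beq [BEq β] [PolyTimeEq β] {f g : α → β} (hf : PolyTime f) (hg : PolyTime g) :
    PolyTime fun a => f a == g a :=
  comp PolyTimeEq.beq (pair hf hg)

instance : PolyTimeEq ℕ := ⟨by fun_prop⟩

instance : PolyTimeEq (List ℕ) := ⟨by
  -- The fold runs through the first list while consuming the second; its flag records whether all
  -- entries so far agreed. The lists are equal when the flag survives and nothing remains of the
  -- second list.
  have key : ∀ (l₁ l₂ : List ℕ) (ok : Bool),
      (fun x : List ℕ × Bool => x.2 && x.1.isEmpty) (l₁.foldl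
        (fun x b => (x.1.tail, x.2 && (x.1.isEmpty.not && x.1.headD 0 == b))) (l₂, ok)) =
        (ok && l₁ == l₂) := by
    intro l₁
    induction l₁ with
    | nil => intro l₂ ok; cases l₂ <;> simp
    | cons a l₁ ih =>
      intro l₂ ok
      rw [List.foldl_cons, ih]
      cases l₂ with
      | nil => simp
      | cons b l₂ =>
        rw [Bool.eq_iff_iff]
        simp only [List.tail_cons, List.isEmpty_cons, List.headD_cons, Bool.and_eq_true,
          beq_iff_eq, List.cons.injEq, Bool.not_false]
        constructor <;> (intro h; grind)
  have fst_eq : ∀ (l₁ : List ℕ) (x : List ℕ × Bool), (l₁.foldl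
        (fun x b => (x.1.tail, x.2 && (x.1.isEmpty.not && x.1.headD 0 == b))) x).1 =
        x.1.drop l₁.length := by
    intro l₁
    induction l₁ with
    | nil => simp
    | cons a l ih => intro x; rw [List.foldl_cons, ih, List.length_cons, List.drop_tail]
  have hB : PolyBoundedOn (fun _ : List ℕ × List ℕ => True) fun x => esize x + 4 :=
    PolyBoundedOn.size.add (.const 4)
  have h := PolyTimeOn.foldl (P := fun _ => True) (l := fun x : List ℕ × List ℕ => x.1)
    (init := fun x => (x.2, true))
    (step := fun _ x b => (x.1.tail, x.2 && (x.1.isEmpty.not && x.1.headD 0 == b)))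
    (Q := fun _ => True) (PolyTime.on (by fun_prop) _) (PolyTime.on (by fun_prop) _)
    (PolyTime.on (by fun_prop) _) (by simp) hB ?_
  · have h' : PolyTime fun x : List ℕ × Bool => x.2 && x.1.isEmpty := by fun_prop
    exact (PolyTimeOn.comp h' h fun _ _ => trivial).congr fun x _ =>
      (key x.1 x.2 true).trans (Bool.true_and _)
  · rintro ⟨l₁, l₂⟩ - l₃ l₄ h
    rw [← Prod.mk.eta (p := List.foldl _ _ l₃), esize_pair, fst_eq]
    have h1 := esize_bool_le (l₃.foldl (fun x b => (x.1.tail, x.2 && (x.1.isEmpty.not &&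
      x.1.headD 0 == b))) (l₂, true)).2
    have h2 := esize_le_of_sublist (List.drop_sublist l₃.length l₂)
    simp only [esize_pair] at *
    omega⟩

@[fun_prop]
theorem list_contains [BEq β] [PolyTimeEq β] {f : α → List β} {g : α → β} (hf : PolyTime f)
    (hg : PolyTime g) : PolyTime fun a => (f a).contains (g a) := by
  simp only [List.contains_eq_any_beq]
  fun_prop

@[fun_prop]
theorem list_idxOf [BEq β] [LawfulBEq β] [PolyTimeEq β] {f : α → β} {g : α → List β} (hf : PolyTime f)
    (hg : PolyTime g) : PolyTime fun a => List.idxOf (f a) (g a) := by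
  -- Here `(List.replicate n () ++ [()]).length` is `n + 1`, expressed through list functions
  -- already known to be polynomial.
  have key : ∀ (b : β) (l : List β),
      l.foldr (fun c n => bif c == b then 0 else (List.replicate n () ++ [()]).length) 0 =
        List.idxOf b l := by
    intro b l
    induction l with
    | nil => rfl
    | cons c l ih => rw [List.foldr_cons, ih, List.idxOf_cons]; simp
  have h := PolyTimeOn.list_foldr (P := fun _ => True) (l := g) (init := fun _ => 0)
    (step := fun a c n => bif c == f a then 0 else (List.replicate n () ++ [()]).length)
    (Q := fun _ => True) (B := fun a => 2 * esize (g a) + 1) hg ((const _).on _)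
    (PolyTime.on (by fun_prop) _) (by simp) (((PolyBoundedOn.const 2).mul hg.bounded).add
      (.const 1)) ?_
  · exact h.congr fun a _ => key _ _
  · intro a _ l₁ l₂ h
    rw [key, esize_nat, h]
    have h1 : l₂.idxOf (f a) ≤ l₂.length := List.idxOf_le_length
    have h2 := length_le_esize l₂
    have h3 := esize_append l₁ l₂
    have := esize_pos l₁
    omega

@[fun_prop]
theorem nub [BEq β] [PolyTimeEq β] : PolyTime (ConsCSP.nub : List β → List β) := by
  refine PolyTimeOn.list_foldr (P := fun _ => True) (l := fun l => l) (init := fun _ => [])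
    (step := fun _ a l => bif l.contains a then l else a :: l) (Q := fun _ => True)
    id ((const _).on _) (PolyTime.on (by fun_prop) _) (by simp) PolyBoundedOn.size ?_
  rintro a - l₁ l₂ rfl
  exact esize_le_of_sublist ((nub_sublist l₂).trans (List.sublist_append_right _ _))

/-- A list of constant length. -/
theorem list_map_const {ι : Type} {g : ι → α → β} (l : List ι) (hg : ∀ i, PolyTime (g i)) :
    PolyTime fun a => l.map fun i => g i a := by
  induction l with
  | nil => exact const _
  | cons i l ih => exact list_cons (hg i) ih

theorem list_flatMap_const {ι : Type} {g : ι → α → List β} (l : List ι)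
    (hg : ∀ i, PolyTime (g i)) : PolyTime fun a => l.flatMap fun i => g i a := by
  simp only [List.flatMap_def]
  exact comp list_flatten (list_map_const l hg)

end PolyTime

/-- All lists of length `k` with entries in `l`. -/
def listsOf {β : Type} (l : List β) : ℕ → List (List β)
  | 0 => [[]]
  | k + 1 => l.flatMap fun a => (listsOf l k).map fun t => a :: t

theorem mem_listsOf {β : Type} {l : List β} {k : ℕ} {t : List β} :
    t ∈ listsOf l k ↔ t.length = k ∧ ∀ a ∈ t, a ∈ l := by
  induction k generalizing t with
  | zero => simp only [listsOf, List.mem_singleton, List.length_eq_zero_iff]; grind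
  | succ k ih =>
    simp only [listsOf, List.mem_flatMap, List.mem_map, ih]
    cases t with
    | nil => simp
    | cons a t => simp; grind

-- The exponent `k` is fixed, so the number of lists is polynomial; the recursion on `k` becomes a
-- composition of `k` programs.
@[fun_prop]
theorem PolyTime.listsOf {f : α → List β} (hf : PolyTime f) (k : ℕ) :
    PolyTime fun a => listsOf (f a) k := by
  induction k with
  | zero => exact const _
  | succ k ih => exact list_flatMap (list_map (by fun_prop) (ih.comp fst)) hf

end

/-! ### Instances and operations in terms of lists of natural numbers -/

/-- A constraint as a scope and a list of tuples. -/
abbrev ListConstraint : Type := List ℕ × List (List ℕ)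

/-- A CSP instance as a number of variables, a number of values and a list of constraints. -/
abbrev ListInstance : Type := ℕ × ℕ × List ListConstraint

/-- The list of the entries of a tuple. -/
def tupleToList {k d : ℕ} (t : Fin k → Fin d) : List ℕ := List.ofFn fun i => (t i : ℕ)

/-- The constraint as a pair of lists. -/
def Constraint.toList {n d : ℕ} (C : Constraint n d) : ListConstraint :=
  (tupleToList C.scope, C.tuples.map tupleToList)

/-- The instance in terms of lists. -/
def Instance.toList (I : Instance) : ListInstance :=
  (I.numVars, I.domSize, I.constraints.map Constraint.toList)

/-- The list `l` has length `k` and its entries are less than `d`. -/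
def IsTuple (d k : ℕ) (l : List ℕ) : Prop := l.length = k ∧ ∀ a ∈ l, a < d

/-- The entries of all lists lie in the right ranges, and tuples are as long as the scopes. -/
def ListInstance.WellFormed (L : ListInstance) : Prop :=
  ∀ c ∈ L.2.2, (∀ v ∈ c.1, v < L.1) ∧ ∀ t ∈ c.2, IsTuple L.2.1 c.1.length t

/-- The instance has a satisfying assignment. -/
def ListInstance.Sat (L : ListInstance) : Prop :=
  ∃ φ : ℕ → ℕ, (∀ v < L.1, φ v < L.2.1) ∧ ∀ c ∈ L.2.2, c.1.map φ ∈ c.2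

/-! ### Passage between typed instances and their list form. -/

theorem tupleToList_injective {k d : ℕ} :
    Function.Injective (tupleToList : (Fin k → Fin d) → List ℕ) := by
  intro s t h
  funext i
  exact Fin.ext (congrFun (List.ofFn_injective h) i)

@[simp] theorem length_tupleToList {k d : ℕ} (t : Fin k → Fin d) :
    (tupleToList t).length = k := by simp [tupleToList]

theorem isTuple_tupleToList {k d : ℕ} (t : Fin k → Fin d) : IsTuple d k (tupleToList t) := by
  refine ⟨length_tupleToList t, fun a ha => ?_⟩
  obtain ⟨i, rfl⟩ := (List.mem_ofFn' _ _).1 ha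
  exact (t i).2

theorem IsTuple.exists_tuple {k d : ℕ} {l : List ℕ} (h : IsTuple d k l) :
    ∃ t : Fin k → Fin d, tupleToList t = l := by
  obtain ⟨rfl, h⟩ := h
  exact ⟨fun i => ⟨l[i], h _ (List.getElem_mem _)⟩, List.ofFn_getElem (xs := l)⟩

theorem map_tupleToList {k n d : ℕ} (t : Fin k → Fin n) {φ : ℕ → ℕ} {ψ : Fin n → Fin d}
    (h : ∀ v : Fin n, φ v = ψ v) : (tupleToList t).map φ = tupleToList fun i => ψ (t i) := by
  simp only [tupleToList, List.map_ofFn]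
  exact congrArg _ (funext fun i => h _)

theorem enc_tupleToList {k d : ℕ} (t : Fin k → Fin d) :
    Enc.enc (tupleToList t) = encodeTuple t := by
  change Data.ofList (List.map _ (List.ofFn _)) = _
  rw [List.map_ofFn]
  rfl

theorem Instance.enc_toList (I : Instance) : Enc.enc I.toList = I.encode := by
  have h : ∀ C : Constraint I.numVars I.domSize, Enc.enc C.toList = C.encode := by
    intro C
    change Data.cons (Enc.enc (tupleToList C.scope)) (Data.ofList (List.map _ (List.map _ _))) = _
    rw [enc_tupleToList, List.map_map, Constraint.encode]
    exact congrArg _ (congrArg _ (List.map_congr_left fun t _ => enc_tupleToList t))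
  change Data.cons _ (Data.cons _ (Data.ofList (List.map _ (List.map _ _)))) = _
  rw [List.map_map, Instance.encode]
  exact congrArg _ (congrArg _ (congrArg _ (List.map_congr_left fun C _ => h C)))

theorem Instance.wellFormed_toList (I : Instance) : I.toList.WellFormed := by
  intro c hc
  obtain ⟨C, -, rfl⟩ := List.mem_map.1 hc
  refine ⟨(isTuple_tupleToList C.scope).2, fun t ht => ?_⟩
  obtain ⟨s, -, rfl⟩ := List.mem_map.1 ht
  simpa [Constraint.toList, Instance.toList] using isTuple_tupleToList s

theorem exists_map_eq {α β : Type} {f : α → β} {l : List β} (h : ∀ b ∈ l, ∃ a, f a = b) :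
    ∃ l' : List α, l'.map f = l := by
  induction l with
  | nil => exact ⟨[], rfl⟩
  | cons b l ih =>
    obtain ⟨a, rfl⟩ := h b (by simp)
    obtain ⟨l', rfl⟩ := ih fun b hb => h b (by simp [hb])
    exact ⟨a :: l', rfl⟩

theorem ListInstance.WellFormed.exists_instance {L : ListInstance} (h : L.WellFormed) :
    ∃ I : Instance, I.toList = L := by
  obtain ⟨n, d, cs⟩ := L
  suffices h' : ∀ c ∈ cs, ∃ C : Constraint n d, C.toList = c by
    obtain ⟨Cs, rfl⟩ := exists_map_eq h'
    exact ⟨⟨n, d, Cs⟩, rfl⟩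
  intro c hc
  obtain ⟨h1, h2⟩ := h c hc
  obtain ⟨s, hs⟩ := IsTuple.exists_tuple (d := n) ⟨rfl, h1⟩
  obtain ⟨ts, hts⟩ := exists_map_eq fun t ht => (h2 t ht).exists_tuple
  exact ⟨⟨_, s, ts⟩, Prod.ext hs hts⟩

theorem Instance.sat_toList (I : Instance) : I.toList.Sat ↔ I.IsSatisfiable := by
  constructor
  · rintro ⟨φ, h1, h2⟩
    let ψ : Fin I.numVars → Fin I.domSize := fun v => ⟨φ v, h1 v v.2⟩
    refine ⟨ψ, fun C hC => ?_⟩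
    have := h2 _ (List.mem_map_of_mem hC)
    simp only [Constraint.toList] at this
    rw [map_tupleToList (ψ := ψ) _ fun _ => rfl] at this
    exact (List.mem_map_of_injective tupleToList_injective).1 this
  · rintro ⟨ψ, h⟩
    refine ⟨fun v => if hv : v < I.numVars then ψ ⟨v, hv⟩ else 0, fun v hv => ?_, fun c hc => ?_⟩
    · have hv' : v < I.numVars := hv
      simp only [hv', dite_true]
      exact (ψ _).2
    · obtain ⟨C, hC, rfl⟩ := List.mem_map.1 hc
      simp only [Constraint.toList]
      rw [map_tupleToList (ψ := ψ) _ fun v => by simp]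
      exact List.mem_map_of_mem (h C hC)

/-- The columns, as lists, of a list of rows of length `r`. -/
def columns (r : ℕ) (rows : List (List ℕ)) : List (List ℕ) :=
  (List.range r).map fun j => rows.map fun t => t.getD j 0

/-- The `k`-ary operation `f` preserves the `r`-ary relation. -/
def Preserves (f : List ℕ → ℕ) (k r : ℕ) (rel : List (List ℕ)) : Prop :=
  ∀ rows : List (List ℕ), rows.length = k → (∀ t ∈ rows, t ∈ rel) →
    (columns r rows).map f ∈ rel

/-- The identity holds for the operations `F` on the values with property `S`. -/
def LinearIdentity.HoldsOn {m : ℕ} {arity : Fin m → ℕ} (S : ℕ → Prop)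
    (F : Fin m → List ℕ → ℕ) : LinearIdentity arity → Prop
  | .opOp i j x y => ∀ φ : ℕ → ℕ, (∀ n, S (φ n)) →
      F i (List.ofFn fun a => φ (x a)) = F j (List.ofFn fun b => φ (y b))
  | .opVar i x y => ∀ φ : ℕ → ℕ, (∀ n, S (φ n)) → F i (List.ofFn fun a => φ (x a)) = φ y

namespace LinearMaltsevCondition

variable (M : LinearMaltsevCondition)

/-- The operations `F` on `{0, …, d - 1}` are conservative and satisfy `M`. -/
structure ConservativeOps (d : ℕ) (F : Fin M.numSymbols → List ℕ → ℕ) : Prop where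
  mem : ∀ i l, IsTuple d (M.arity i) l → F i l ∈ l
  holds : ∀ e ∈ M.identities, e.HoldsOn (· < d) F

/-- The operations `F` are conservative polymorphisms of the instance and satisfy `M`. -/
structure ConservativePolymorphisms (L : ListInstance) (F : Fin M.numSymbols → List ℕ → ℕ) :
    Prop where
  wellFormed : L.WellFormed
  ops : M.ConservativeOps L.2.1 F
  preserves : ∀ c ∈ L.2.2, ∀ i, Preserves (F i) (M.arity i) c.1.length c.2

/-- The tables of the operations `F`. -/
def tables (d : ℕ) (F : Fin M.numSymbols → List ℕ → ℕ) : List (List (List ℕ × ℕ)) :=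
  (List.finRange M.numSymbols).map fun i =>
    (listsOf (List.range d) (M.arity i)).map fun t => (t, F i t)

end LinearMaltsevCondition

theorem map_allTuples (d k : ℕ) :
    (allTuples d k).map tupleToList = listsOf (List.range d) k := by
  induction k with
  | zero => simp [allTuples, listsOf, tupleToList]
  | succ k ih =>
    rw [allTuples, listsOf, ← ih, ← List.map_coe_finRange_eq_range]
    simp only [List.map_flatMap, List.flatMap_map, List.map_map]
    refine List.flatMap_congr fun a _ => List.map_congr_left fun t _ => ?_
    simp [tupleToList, List.ofFn_succ]

theorem enc_table {k d : ℕ} {f : (Fin k → Fin d) → Fin d} {g : List ℕ → ℕ}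
    (h : ∀ t, g (tupleToList t) = f t) :
    Enc.enc ((listsOf (List.range d) k).map fun t => (t, g t)) = encodeOperation f := by
  rw [← map_allTuples]
  change Data.ofList (List.map _ (List.map _ (List.map _ _))) = _
  rw [List.map_map, List.map_map, encodeOperation]
  refine congrArg _ (List.map_congr_left fun t _ => ?_)
  change Data.cons (Enc.enc (tupleToList t)) (Data.ofNat (g (tupleToList t))) = _
  rw [enc_tupleToList, h]

theorem columns_ofFn {k r d : ℕ} (t : Fin k → Fin r → Fin d) :
    columns r (List.ofFn fun i => tupleToList (t i)) =
      List.ofFn fun j => tupleToList fun i => t i j := by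
  refine List.ext_getElem (by simp [columns]) fun j h1 h2 => ?_
  have hj : j < r := by simpa using h2
  simp only [columns, List.getElem_map, List.getElem_range, List.getElem_ofFn, List.map_ofFn,
    tupleToList]
  refine congrArg _ (funext fun i => ?_)
  simp [hj]

theorem exists_rows {k r d : ℕ} {rel : List (Fin r → Fin d)} {rows : List (List ℕ)}
    (hk : rows.length = k) (h : ∀ t ∈ rows, t ∈ rel.map tupleToList) :
    ∃ t : Fin k → Fin r → Fin d, (rows = List.ofFn fun i => tupleToList (t i)) ∧
      ∀ i, t i ∈ rel := by
  subst hk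
  have h' : ∀ i : Fin rows.length, ∃ s ∈ rel, tupleToList s = rows[i] := fun i =>
    List.mem_map.1 (h _ (List.getElem_mem _))
  choose t ht1 ht2 using h'
  refine ⟨t, ?_, ht1⟩
  simp only [ht2]
  exact (List.ofFn_getElem (xs := rows)).symm

theorem mem_tupleToList {k d : ℕ} {t : Fin k → Fin d} {a : ℕ} :
    a ∈ tupleToList t ↔ ∃ i, (t i : ℕ) = a := by
  simp [tupleToList, List.mem_ofFn']

namespace LinearMaltsevCondition

variable {M : LinearMaltsevCondition}

/-- Conservativity of `F` is used twice: it keeps values below the domain size, so that `F` induces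
operations on `Fin`, and it gives preservation of every unary relation. -/
theorem ConservativePolymorphisms.exists_pairedInstance {L : ListInstance}
    {F : Fin M.numSymbols → List ℕ → ℕ} (h : M.ConservativePolymorphisms L F) :
    ∃ P : M.PairedInstance, M.encodePaired P = Enc.enc (L, M.tables L.2.1 F) ∧
      M.ArePolymorphismsSatisfying P.2 P.1.language.conservativeExtension ∧
      (P.1.IsSatisfiable ↔ L.Sat) := by
  obtain ⟨I, rfl⟩ := h.wellFormed.exists_instance
  have hd : I.toList.2.1 = I.domSize := rfl
  have hlt : ∀ i (t : Fin (M.arity i) → Fin I.domSize), F i (tupleToList t) < I.domSize :=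
    fun i t => (isTuple_tupleToList t).2 _ (h.ops.mem i _ (isTuple_tupleToList t))
  let G : M.Interpretation (Fin I.domSize) := fun i t => ⟨F i (tupleToList t), hlt i t⟩
  have hG : ∀ i t, F i (tupleToList t) = G i t := fun _ _ => rfl
  refine ⟨⟨I, G⟩, ?_, ⟨?_, ?_⟩, I.sat_toList.symm⟩
  · change Data.cons _ _ = Data.cons (Enc.enc I.toList)
      (Data.ofList (List.map _ (List.map _ _)))
    rw [I.enc_toList, List.map_map, List.ofFn_eq_map]
    exact congrArg _ (congrArg _ (List.map_congr_left fun i _ => (enc_table (hG i)).symm))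
  · rintro i ⟨r, R⟩ (⟨C, hC, hR⟩ | hR) t ht
    · obtain ⟨rfl, hR⟩ := Sigma.mk.inj hR
      obtain rfl := eq_of_heq hR
      have := h.preserves _ (List.mem_map_of_mem hC) i (List.ofFn fun i => tupleToList (t i))
        (by simp) (by
          intro s hs
          obtain ⟨j, rfl⟩ := (List.mem_ofFn' _ _).1 hs
          exact List.mem_map_of_mem (ht j))
      simp only [Constraint.toList, length_tupleToList, columns_ofFn, List.map_ofFn] at this
      exact (List.mem_map_of_injective tupleToList_injective).1 this
    · obtain rfl : r = 1 := hR
      obtain ⟨k, hk⟩ := mem_tupleToList.1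
        (h.ops.mem i _ (isTuple_tupleToList fun k => t k 0))
      have : (fun j => G i fun k => t k j) = t k := by
        funext j
        rw [Subsingleton.elim j 0]
        exact Fin.ext hk.symm
      exact this ▸ ht k
  · intro e he
    have := h.ops.holds e he
    cases e with
    | opOp i j x y => exact fun φ => Fin.ext (this (fun n => φ n) fun n => (φ n).2)
    | opVar i x y => exact fun φ => Fin.ext (this (fun n => φ n) fun n => (φ n).2)

theorem exists_conservativePolymorphisms {I : Instance}
    (h : I.language.conservativeExtension.Satisfies M) :
    ∃ F, M.ConservativePolymorphisms I.toList F := by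
  classical
  obtain ⟨G, hG, hM⟩ := h
  let F : Fin M.numSymbols → List ℕ → ℕ := fun i l =>
    if h : ∃ t : Fin (M.arity i) → Fin I.domSize, tupleToList t = l then G i h.choose else 0
  have hF : ∀ i t, F i (tupleToList t) = G i t := by
    intro i t
    have h : ∃ s : Fin (M.arity i) → Fin I.domSize, tupleToList s = tupleToList t := ⟨t, rfl⟩
    have h' : F i (tupleToList t) = G i h.choose := dif_pos h
    rw [h', tupleToList_injective h.choose_spec]
  refine ⟨F, I.wellFormed_toList, ⟨?_, ?_⟩, ?_⟩
  · intro i l hl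
    obtain ⟨t, rfl⟩ := hl.exists_tuple (d := I.domSize)
    rw [hF]
    -- Preservation of the unary relation formed by the entries of `t` says that the value at `t` is
    -- one of these entries.
    obtain ⟨k, hk⟩ := hG i ⟨1, {s | ∃ k, t k = s 0}⟩ (Or.inr rfl) (fun k _ => t k)
      fun k => ⟨k, rfl⟩
    exact mem_tupleToList.2 ⟨k, congrArg _ hk⟩
  · intro e he
    have := hM e he
    cases e with
    | opOp i j x y =>
      intro φ hφ
      have h := congrArg Fin.val (this fun n => ⟨φ n, hφ n⟩)
      rw [← hF, ← hF] at h
      exact h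
    | opVar i x y =>
      intro φ hφ
      have h := congrArg Fin.val (this fun n => ⟨φ n, hφ n⟩)
      rw [← hF] at h
      exact h
  · intro c hc i rows hk hrows
    obtain ⟨C, hC, rfl⟩ := List.mem_map.1 hc
    obtain ⟨t, rfl, ht⟩ := exists_rows hk hrows
    have := hG i C.relation (Or.inl ⟨C, hC, rfl⟩) t ht
    simp only [Constraint.toList, length_tupleToList, columns_ofFn, List.map_ofFn]
    refine List.mem_map.2 ⟨_, this, ?_⟩
    exact congrArg _ (funext fun j => (hF i _).symm)

open Classical in
/-- A semiuniform algorithm, in terms of lists. -/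
theorem HasSemiuniformAlgorithmForConservative.polyTimeOn
    (h : M.HasSemiuniformAlgorithmForConservative) :
    PolyTimeOn (fun x : ListInstance × List (List (List ℕ × ℕ)) =>
      ∃ F, M.ConservativePolymorphisms x.1 F ∧ x.2 = M.tables x.1.2.1 F)
      fun x => decide x.1.Sat := by
  obtain ⟨p, q, h⟩ := h
  -- An accepting run may return any tree other than the leaf; the conditional turns it into the
  -- code of `true`.
  refine ⟨.ite p (.cons .nil .nil) .nil, fun x => q.eval (esize x) + 4,
    (PolyBoundedOn.add ⟨q, fun _ _ => le_rfl⟩ (.const 4)),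
    (PolyBoundedOn.const 3).of_le fun _ _ => esize_bool_le _, ?_⟩
  rintro ⟨L, T⟩ ⟨F, hF, hT⟩
  obtain rfl : T = M.tables L.2.1 F := hT
  obtain ⟨P, hP, hgood, hsat⟩ := hF.exists_pairedInstance
  obtain ⟨y, t, r, ht, hy⟩ := h P hgood
  rw [hP] at r ht
  have ht' : t ≤ q.eval (esize (L, M.tables L.2.1 F)) := ht
  beta_reduce at hy
  rw [hsat] at hy
  beta_reduce
  cases y with
  | nil =>
    have : decide L.Sat = false := decide_eq_false fun h => hy.2 h rfl
    rw [this]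
    exact ⟨t + 1 + 1, by omega, .iteFalse r (.nil _)⟩
  | cons a b =>
    have : decide L.Sat = true := decide_eq_true (hy.1 (by simp))
    rw [this]
    exact ⟨t + (1 + 1 + 1) + 1, by omega, .iteTrue r (.cons (.nil _) (.nil _))⟩

open Classical in
/-- A uniform algorithm, in terms of lists. -/
theorem hasUniformAlgorithmForConservative_of_polyTimeOn
    (h : PolyTimeOn (fun L : ListInstance => ∃ F, M.ConservativePolymorphisms L F)
      fun L => decide L.Sat) : M.HasUniformAlgorithmForConservative := by
  obtain ⟨p, T, ⟨q, hq⟩, -, h⟩ := h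
  refine ⟨p, q, fun I hI => ?_⟩
  have hI' := exists_conservativePolymorphisms hI
  obtain ⟨t, ht, r⟩ := h _ hI'
  have hq := hq _ hI'
  rw [esize, I.enc_toList] at hq
  rw [I.enc_toList] at r
  refine ⟨_, t, r, ht.trans hq, ?_⟩
  beta_reduce
  rw [← I.sat_toList]
  by_cases hs : I.toList.Sat
  · simp [hs, Enc.enc]
  · simp [hs, Enc.enc]

end LinearMaltsevCondition

/-! ### Duplicate removal and positions in lists. -/

theorem mem_nub {β : Type} [BEq β] [LawfulBEq β] {l : List β} {a : β} : a ∈ nub l ↔ a ∈ l := by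
  induction l with
  | nil => rfl
  | cons b l ih =>
    change a ∈ (bif (nub l).contains b then nub l else b :: nub l) ↔ _
    cases h : (nub l).contains b
    · simp [ih]
    · rw [List.contains_iff_mem] at h
      simp only [cond_true, ih, List.mem_cons]
      refine ⟨Or.inr, ?_⟩
      rintro (rfl | h')
      · exact ih.1 h
      · exact h'

theorem nodup_nub {β : Type} [BEq β] [LawfulBEq β] (l : List β) : (nub l).Nodup := by
  induction l with
  | nil => exact List.nodup_nil
  | cons b l ih =>
    change (bif (nub l).contains b then nub l else b :: nub l).Nodup
    cases h : (nub l).contains b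
    · refine List.nodup_cons.2 ⟨fun h' => ?_, ih⟩
      rw [← List.contains_iff_mem, h] at h'
      cases h'
    · exact ih

theorem getD_idxOf {β : Type} [BEq β] [LawfulBEq β] {l : List β} {a : β} (d : β) (h : a ∈ l) :
    l.getD (l.idxOf a) d = a := by
  rw [List.getD_eq_getElem _ _ (List.idxOf_lt_length_of_mem h), List.getElem_idxOf]

theorem getD_mem {β : Type} {l : List β} {n : ℕ} (d : β) (h : n < l.length) :
    l.getD n d ∈ l := by
  rw [List.getD_eq_getElem _ _ h]
  exact List.getElem_mem h

theorem idxOf_getD {β : Type} [BEq β] [LawfulBEq β] {l : List β} (hl : l.Nodup) {n : ℕ} (d : β)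
    (h : n < l.length) : l.idxOf (l.getD n d) = n := by
  rw [List.getD_eq_getElem _ _ h, hl.idxOf_getElem]

/-! ### Instances with a separate domain for every variable -/

/-- Variables, each with the list of its possible values. Variables are lists of numbers. -/
abbrev Domains : Type := List (List ℕ × List ℕ)

/-- Constraints whose scopes are lists of variables. -/
abbrev VarConstraint : Type := List (List ℕ) × List (List ℕ)

/-- The list of possible values of a variable. -/
def lookup (dm : Domains) (v : List ℕ) : List ℕ :=
  ((dm.filter fun e => e.1 == v).map fun e => e.2).headD []

theorem lookup_eq_nil_or (dm : Domains) (v : List ℕ) :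
    ((∀ e ∈ dm, e.1 ≠ v) ∧ lookup dm v = []) ∨ ∃ e ∈ dm, e.1 = v ∧ lookup dm v = e.2 := by
  cases hl : dm.filter fun e => e.1 == v with
  | nil =>
    refine Or.inl ⟨fun e he hev => ?_, by simp [lookup, hl]⟩
    rw [List.filter_eq_nil_iff] at hl
    exact hl e he (by simpa using hev)
  | cons e l =>
    have : e ∈ dm.filter fun e => e.1 == v := by simp [hl]
    rw [List.mem_filter, beq_iff_eq] at this
    exact Or.inr ⟨e, this.1, this.2, by simp [lookup, hl]⟩

theorem exists_of_mem_lookup {dm : Domains} {v : List ℕ} {c : ℕ} (h : c ∈ lookup dm v) :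
    ∃ e ∈ dm, e.1 = v ∧ lookup dm v = e.2 := by
  refine (lookup_eq_nil_or dm v).resolve_left fun h' => ?_
  simp [h'.2] at h

theorem eq_of_fst_eq {dm : Domains} (h : (dm.map Prod.fst).Nodup) {e e' : List ℕ × List ℕ}
    (he : e ∈ dm) (he' : e' ∈ dm) (h' : e.1 = e'.1) : e = e' :=
  List.inj_on_of_nodup_map h he he' h'

theorem lookup_eq {dm : Domains} (h : (dm.map Prod.fst).Nodup) {e : List ℕ × List ℕ}
    (he : e ∈ dm) : lookup dm e.1 = e.2 := by
  obtain ⟨h', -⟩ | ⟨e', he', h1, h2⟩ := lookup_eq_nil_or dm e.1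
  · exact absurd rfl (h' e he)
  · rw [h2, eq_of_fst_eq h he' he h1]

/-- An assignment satisfies the constraints and respects the domains. -/
def IsSolution (cs : List VarConstraint) (dm : Domains) (ψ : List ℕ → ℕ) : Prop :=
  (∀ e ∈ dm, ψ e.1 ∈ e.2) ∧ ∀ c ∈ cs, c.1.map ψ ∈ c.2

/-- The disjoint union of the domains: the list of all `a :: v` where `a` is a value of `v`. -/
def elements (dm : Domains) : List (List ℕ) :=
  nub (dm.flatMap fun e => e.2.map fun a => a :: e.1)

theorem mem_elements {dm : Domains} {w : List ℕ} :
    w ∈ elements dm ↔ ∃ e ∈ dm, ∃ a ∈ e.2, a :: e.1 = w := by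
  simp [elements, mem_nub]

theorem nodup_elements (dm : Domains) : (elements dm).Nodup := nodup_nub _

theorem cons_mem_elements {dm : Domains} (h : (dm.map Prod.fst).Nodup) {e : List ℕ × List ℕ}
    (he : e ∈ dm) {a : ℕ} : a :: e.1 ∈ elements dm ↔ a ∈ e.2 := by
  rw [mem_elements]
  constructor
  · rintro ⟨e', he', a', ha', h'⟩
    obtain rfl := (List.cons.inj h').1
    rwa [← eq_of_fst_eq h he' he (List.cons.inj h').2]
  · exact fun ha => ⟨e, he, a, ha, rfl⟩

/-- The tuple `t`, each entry joined with the corresponding variable. -/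
def tagTuple (vs : List (List ℕ)) (t : List ℕ) : List (List ℕ) :=
  (List.range vs.length).map fun j => t.getD j 0 :: vs.getD j []

/-- The constraint on the disjoint union of the domains. -/
def tagConstraint (dm : Domains) (c : VarConstraint) : ListConstraint :=
  (c.1.map fun v => List.idxOf v (dm.map fun e => e.1),
    ((c.2.map fun t => tagTuple c.1 t).filter fun t =>
      t.all fun w => (elements dm).contains w).map fun t =>
        t.map fun w => List.idxOf w (elements dm))

/-- The domain of a variable as a unary constraint. -/
def domainConstraint (e : List ℕ × List ℕ) : VarConstraint := ([e.1], e.2.map fun a => [a])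

/-- The constraints, as an instance over the disjoint union of the domains. -/
def taggedInstance (cs : List VarConstraint) (dm : Domains) : ListInstance :=
  (dm.length, (elements dm).length,
    (cs ++ dm.map fun e => domainConstraint e).map fun c => tagConstraint dm c)

/-- The variables of the scopes occur among the variables of `dm`, and tuples are as long as the
scopes. -/
def ScopesIn (cs : List VarConstraint) (dm : Domains) : Prop :=
  ∀ c ∈ cs, (∀ v ∈ c.1, v ∈ dm.map Prod.fst) ∧ ∀ t ∈ c.2, t.length = c.1.length

theorem mem_tagConstraint {dm : Domains} {c : VarConstraint} {s : List ℕ} :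
    s ∈ (tagConstraint dm c).2 ↔ ∃ t ∈ c.2, (∀ w ∈ tagTuple c.1 t, w ∈ elements dm) ∧
      ((tagTuple c.1 t).map fun w => List.idxOf w (elements dm)) = s := by
  simp [tagConstraint, and_assoc]

theorem ScopesIn.append_domainConstraints {cs : List VarConstraint} {dm : Domains}
    (h : ScopesIn cs dm) : ScopesIn (cs ++ dm.map fun e => domainConstraint e) dm := by
  intro c hc
  rcases List.mem_append.1 hc with hc | hc
  · exact h c hc
  · obtain ⟨e, he, rfl⟩ := List.mem_map.1 hc
    constructor
    · intro v hv
      obtain rfl : v = e.1 := by simpa [domainConstraint] using hv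
      exact List.mem_map_of_mem he
    · intro t ht
      obtain ⟨a, -, rfl⟩ := List.mem_map.1 ht
      rfl

theorem getD_range_map {β : Type} (f : ℕ → β) {n j : ℕ} (h : j < n) (d : β) :
    ((List.range n).map f).getD j d = f j := by
  rw [List.getD_eq_getElem _ _ (by simpa using h)]
  simp

theorem map_eq_range_map {β γ : Type} (f : β → γ) (l : List β) (d : β) :
    l.map f = (List.range l.length).map fun j => f (l.getD j d) := by
  refine List.ext_getElem (by simp) fun j h1 h2 => ?_
  have : j < l.length := by simpa using h1
  simp [this]

theorem wellFormed_taggedInstance {cs : List VarConstraint} {dm : Domains}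
    (h : ScopesIn cs dm) : (taggedInstance cs dm).WellFormed := by
  intro c hc
  obtain ⟨c, hc', rfl⟩ := List.mem_map.1 hc
  obtain ⟨h1, -⟩ := h.append_domainConstraints c hc'
  constructor
  · intro v hv
    obtain ⟨w, hw, rfl⟩ := List.mem_map.1 hv
    have := List.idxOf_lt_length_of_mem (h1 w hw)
    rwa [List.length_map] at this
  · intro s hs
    obtain ⟨t, -, ht, rfl⟩ := mem_tagConstraint.1 hs
    refine ⟨by simp [tagTuple, tagConstraint], fun a ha => ?_⟩
    obtain ⟨w, hw, rfl⟩ := List.mem_map.1 ha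
    exact List.idxOf_lt_length_of_mem (ht w hw)

/-- The value `a` of `v` becomes the element `a :: v`. Tuples of a tagged constraint carry the
variables of its scope as tags, so dropping the tags turns solutions into solutions, and the added
domain constraints keep every variable in its domain. -/
theorem sat_taggedInstance {cs : List VarConstraint} {dm : Domains}
    (hdm : (dm.map Prod.fst).Nodup) (h : ScopesIn cs dm) :
    (taggedInstance cs dm).Sat ↔ ∃ ψ, IsSolution cs dm ψ := by
  have h' := h.append_domainConstraints
  constructor
  · rintro ⟨φ, -, hφ⟩
    let ψ : List ℕ → ℕ := fun v =>
      ((elements dm).getD (φ (List.idxOf v (dm.map fun e => e.1))) []).headD 0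
    have key : ∀ c ∈ cs ++ dm.map (fun e => domainConstraint e), c.1.map ψ ∈ c.2 := by
      intro c hc
      obtain ⟨t, ht, hE, hs⟩ := mem_tagConstraint.1 (hφ _ (List.mem_map_of_mem hc))
      convert ht using 1
      have hlen := (h' c hc).2 t ht
      refine List.ext_getElem (by simp [hlen]) fun j h1 h2 => ?_
      have hj : j < c.1.length := by simpa using h1
      have hw := hE (t[j] :: c.1[j]) (List.mem_map.2 ⟨j, by simpa using hj, by simp [hj, h2]⟩)
      have hs' := congrArg (fun l => l.getD j 0) hs
      simp only [tagConstraint, tagTuple, List.map_map] at hs'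
      rw [getD_range_map _ hj, List.getD_eq_getElem _ _ (by simpa using hj)] at hs'
      simp only [List.getElem_map, Function.comp_apply, List.getD_eq_getElem _ _ hj,
        List.getD_eq_getElem _ _ h2] at hs'
      simp only [List.getElem_map, ψ]
      rw [← hs', getD_idxOf _ hw, List.headD_cons]
    refine ⟨ψ, fun e he => ?_, fun c hc => key c (List.mem_append_left _ hc)⟩
    have := key (domainConstraint e) (List.mem_append_right _ (List.mem_map_of_mem he))
    simpa [domainConstraint] using this
  · rintro ⟨ψ, h1, h2⟩
    have key : ∀ c ∈ cs ++ dm.map (fun e => domainConstraint e), c.1.map ψ ∈ c.2 := by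
      intro c hc
      rcases List.mem_append.1 hc with hc | hc
      · exact h2 c hc
      · obtain ⟨e, he, rfl⟩ := List.mem_map.1 hc
        simpa [domainConstraint] using h1 e he
    have hE : ∀ v ∈ dm.map Prod.fst, ψ v :: v ∈ elements dm := by
      intro v hv
      obtain ⟨e, he, rfl⟩ := List.mem_map.1 hv
      exact (cons_mem_elements hdm he).2 (h1 e he)
    refine ⟨fun x => List.idxOf (ψ ((dm.map fun e => e.1).getD x []) ::
      (dm.map fun e => e.1).getD x []) (elements dm), fun x hx => ?_, fun c hc => ?_⟩
    · exact List.idxOf_lt_length_of_mem (hE _ (getD_mem _ (by simpa [taggedInstance] using hx)))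
    · obtain ⟨c, hc', rfl⟩ := List.mem_map.1 hc
      refine mem_tagConstraint.2 ⟨_, key c hc', ?_, ?_⟩
      · intro w hw
        obtain ⟨j, hj, rfl⟩ := List.mem_map.1 hw
        rw [List.mem_range] at hj
        rw [List.getD_eq_getElem _ _ (by simpa using hj), List.getD_eq_getElem _ _ hj,
          List.getElem_map]
        exact hE _ ((h' c hc').1 _ (List.getElem_mem _))
      · simp only [tagConstraint, List.map_map, tagTuple]
        rw [map_eq_range_map ψ c.1 [], map_eq_range_map (_ ∘ _) c.1 []]
        refine List.map_congr_left fun j hj => ?_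
        rw [List.mem_range] at hj
        have hv := (h' c hc').1 _ (getD_mem [] hj)
        simp only [Function.comp_apply]
        rw [getD_idxOf (l := dm.map fun e => e.1) [] hv, getD_range_map _ hj]

/-! ### Operations on the disjoint union of the domains -/

/-- The operation on `{0, …, e - 1}` built from the operation `b` on `{0, 1}`: the first `n` such
that `b` is `0` at the tuple of the truth values of `n < x`. -/
def chain (b : List ℕ → ℕ) (e : ℕ) (ns : List ℕ) : ℕ :=
  ((List.range e).filter fun n =>
    b (ns.map fun x => bif decide (n < x) then 1 else 0) == 0).headD 0

/-- The operation on the disjoint union of the domains built from an operation `b` on `{0, 1}`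
and an operation `f` that is defined on each of the domains. -/
def mix (b f : List ℕ → ℕ) (dm : Domains) (ns : List ℕ) : ℕ :=
  let n := chain b (elements dm).length ns
  let v := ((elements dm).getD n []).tail
  let us := (lookup dm v).map fun c => f (ns.map fun k =>
    bif ((elements dm).getD k []).tail == v then ((elements dm).getD k []).headD 0 else c)
  bif us.all fun u => u == us.headD 0 then List.idxOf (us.headD 0 :: v) (elements dm) else n

theorem chain_eq {b : List ℕ → ℕ} {e n : ℕ} {ns : List ℕ} (hn : n < e)
    (h : b (ns.map fun x => bif decide (n < x) then 1 else 0) = 0)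
    (h' : ∀ k < n, b (ns.map fun x => bif decide (k < x) then 1 else 0) ≠ 0) :
    chain b e ns = n := by
  have : (List.range e).find? (fun n =>
      b (ns.map fun x => bif decide (n < x) then 1 else 0) == 0) = some n := by
    rw [List.find?_range_eq_some]
    simpa [hn, h] using h'
  rw [chain, List.headD_eq_head?_getD, List.head?_filter, this]
  rfl

/-- At `n = e` all threshold bits are `0`, so a first `n` with value `0` exists. If that `n` were
not an entry of `ns`, then either `n = 0` and all bits are `1`, so `b` cannot return `0`, or the
bits at `n - 1` and at `n` coincide and `n` is not the first. -/
theorem chain_mem {b : List ℕ → ℕ} {e k : ℕ} {ns : List ℕ}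
    (hb : ∀ l, IsTuple 2 k l → b l ∈ l) (hns : IsTuple e k ns) : chain b e ns ∈ ns := by
  have hbit : ∀ n, b (ns.map fun x => bif decide (n < x) then 1 else 0) ∈
      ns.map fun x => bif decide (n < x) then 1 else 0 := by
    intro n
    refine hb _ ⟨by simpa using hns.1, fun a ha => ?_⟩
    obtain ⟨x, -, rfl⟩ := List.mem_map.1 ha
    cases decide (n < x) <;> simp
  have hex : ∃ n, b (ns.map fun x => bif decide (n < x) then 1 else 0) = 0 := by
    refine ⟨e, ?_⟩
    obtain ⟨x, hx, h⟩ := List.mem_map.1 (hbit e)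
    have := hns.2 x hx
    rw [← h, decide_eq_false (by omega)]
    rfl
  classical
  have h0 := Nat.find_spec hex
  have hmin : ∀ k < Nat.find hex, _ := fun k hk => Nat.find_min hex hk
  have hmem : Nat.find hex ∈ ns := by
    by_contra hn
    obtain ⟨x, hx, h⟩ := List.mem_map.1 (hbit (Nat.find hex))
    rcases Nat.eq_zero_or_pos (Nat.find hex) with hz | hpos
    · rw [h0] at h
      have hx0 : x ≠ 0 := fun hx0 => hn (hz.trans hx0.symm ▸ hx)
      rw [decide_eq_true (by omega)] at h
      simp at h
    · refine hmin (Nat.find hex - 1) (by omega) ?_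
      refine Eq.trans ?_ h0
      refine congrArg b (List.map_congr_left fun x hx => ?_)
      have : x ≠ Nat.find hex := by rintro rfl; exact hn hx
      have : (Nat.find hex - 1 < x) ↔ (Nat.find hex < x) := by omega
      simp only [this]
  rw [chain_eq (hns.2 _ hmem) h0 hmin]
  exact hmem

section Mix

variable {dm : Domains} {b f : List ℕ → ℕ} {k : ℕ}

theorem exists_getD_elements {n : ℕ} (hn : n < (elements dm).length) :
    ∃ e ∈ dm, ∃ a ∈ e.2, (elements dm).getD n [] = a :: e.1 := by
  obtain ⟨e, he, a, ha, h⟩ := mem_elements.1 (getD_mem [] hn)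
  exact ⟨e, he, a, ha, h.symm⟩

/-- If all results on the domain of the chosen variable agree, `mix` returns them. -/
theorem mix_eq {ns : List ℕ} {n : ℕ} {e : List ℕ × List ℕ} {a u : ℕ}
    (hdm : (dm.map Prod.fst).Nodup) (he : e ∈ dm) (ha : a ∈ e.2)
    (hn : chain b (elements dm).length ns = n) (hw : (elements dm).getD n [] = a :: e.1)
    (hu : ∀ c ∈ e.2, f (ns.map fun k => bif ((elements dm).getD k []).tail == e.1 then
      ((elements dm).getD k []).headD 0 else c) = u) :
    mix b f dm ns = List.idxOf (u :: e.1) (elements dm) := by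
  have h1 : (e.2.map fun c => f (ns.map fun k => bif ((elements dm).getD k []).tail == e.1 then
      ((elements dm).getD k []).headD 0 else c)) = e.2.map fun _ => u :=
    List.map_congr_left hu
  have h2 : (e.2.map fun _ => u).headD 0 = u := by
    obtain ⟨x, l⟩ := e
    cases l with
    | nil => simp at ha
    | cons => rfl
  simp only [mix, hn, hw, List.tail_cons, lookup_eq hdm he, h1, h2]
  rw [show ((e.2.map fun _ => u).all fun x => x == u) = true by simp]
  rfl

/-- The critical case is a common result `u` for all fillers `c`. If some filler differs from `u`,
then conservativity of `f` for this filler shows that `u` comes from a genuine argument in the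
chosen domain. Otherwise the domain is `{u}`, and the element picked by `chain` is the tagged `u`.
-/
theorem mix_mem {ns : List ℕ} (hdm : (dm.map Prod.fst).Nodup)
    (hb : ∀ l, IsTuple 2 k l → b l ∈ l)
    (hf : ∀ e ∈ dm, ∀ l : List ℕ, l.length = k → (∀ a ∈ l, a ∈ e.2) → f l ∈ l)
    (hns : IsTuple (elements dm).length k ns) : mix b f dm ns ∈ ns := by
  have hmem := chain_mem hb hns
  set n := chain b (elements dm).length ns with hn
  obtain ⟨e, he, a, ha, hw⟩ := exists_getD_elements (hns.2 n hmem)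
  by_cases hall : ∃ u, ∀ c ∈ e.2, f (ns.map fun k =>
      bif ((elements dm).getD k []).tail == e.1 then
        ((elements dm).getD k []).headD 0 else c) = u
  · obtain ⟨u, hu⟩ := hall
    rw [mix_eq hdm he ha hn.symm hw hu]
    by_cases hc : ∃ c ∈ e.2, c ≠ u
    · obtain ⟨c, hc, hcu⟩ := hc
      have := hf e he (ns.map fun k => bif ((elements dm).getD k []).tail == e.1 then
        ((elements dm).getD k []).headD 0 else c) (by simpa using hns.1) (by
          intro x hx
          obtain ⟨m, hm, rfl⟩ := List.mem_map.1 hx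
          obtain ⟨e', he', a', ha', hw'⟩ := exists_getD_elements (hns.2 m hm)
          rw [hw']
          by_cases hee : e'.1 = e.1
          · rw [← eq_of_fst_eq hdm he' he hee]
            simpa using ha'
          · have : (e'.1 == e.1) = false := by simpa using hee
            simpa [this] using hc)
      rw [hu c hc] at this
      obtain ⟨m, hm, hmu⟩ := List.mem_map.1 this
      obtain ⟨e', he', a', ha', hw'⟩ := exists_getD_elements (hns.2 m hm)
      rw [hw'] at hmu
      by_cases hee : e'.1 = e.1
      · simp only [List.tail_cons, hee, beq_self_eq_true, cond_true, List.headD_cons] at hmu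
        rw [← hmu, ← hee, ← hw', idxOf_getD (nodup_elements dm) _ (hns.2 m hm)]
        exact hm
      · have : (e'.1 == e.1) = false := by simpa using hee
        simp only [List.tail_cons, this, cond_false] at hmu
        exact absurd hmu hcu
    · push Not at hc
      rw [← hc a ha, ← hw, idxOf_getD (nodup_elements dm) _ (hns.2 n hmem)]
      exact hmem
  · have hall' : ((e.2.map fun c => f (ns.map fun k =>
        bif ((elements dm).getD k []).tail == e.1 then
          ((elements dm).getD k []).headD 0 else c)).all fun u => u ==
        (e.2.map fun c => f (ns.map fun k =>
        bif ((elements dm).getD k []).tail == e.1 then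
          ((elements dm).getD k []).headD 0 else c)).headD 0) = false := by
      by_contra h
      rw [Bool.not_eq_false, List.all_eq_true] at h
      exact hall ⟨_, fun c hc => by simpa using h _ (List.mem_map_of_mem hc)⟩
    simp only [mix, ← hn, hw, List.tail_cons, lookup_eq hdm he, hall', cond_false]
    exact hmem

/-- All arguments carry the same tag, so `chain` can only choose that domain and no argument is
replaced by a filler. -/
theorem mix_column {x : List ℕ} {e : List ℕ × List ℕ} (hdm : (dm.map Prod.fst).Nodup)
    (hb : ∀ l, IsTuple 2 k l → b l ∈ l) (he : e ∈ dm) (hx : x.length = k)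
    (hxe : ∀ a ∈ x, a ∈ e.2) :
    mix b f dm (x.map fun a => List.idxOf (a :: e.1) (elements dm)) =
      List.idxOf (f x :: e.1) (elements dm) := by
  have hE : ∀ a ∈ x, a :: e.1 ∈ elements dm := fun a ha =>
    (cons_mem_elements hdm he).2 (hxe a ha)
  have hmem := chain_mem (e := (elements dm).length)
    (ns := x.map fun a => List.idxOf (a :: e.1) (elements dm)) hb ⟨by simpa using hx, by
      intro n hn
      obtain ⟨a, ha, rfl⟩ := List.mem_map.1 hn
      exact List.idxOf_lt_length_of_mem (hE a ha)⟩
  obtain ⟨a, ha, han⟩ := List.mem_map.1 hmem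
  refine mix_eq hdm he (hxe a ha) rfl (by rw [← han, getD_idxOf _ (hE a ha)]) fun c _ => ?_
  congr 1
  rw [List.map_map]
  conv_rhs => rw [← List.map_id x]
  refine List.map_congr_left fun a ha => ?_
  simp only [Function.comp_apply, getD_idxOf _ (hE a ha)]
  simp

end Mix

theorem exists_rows_eq {β : Type} {f : β → List ℕ} {P : β → Prop} {rows : List (List ℕ)}
    (h : ∀ t ∈ rows, ∃ s, P s ∧ f s = t) :
    ∃ rows' : List β, (∀ s ∈ rows', P s) ∧ rows'.map f = rows := by
  obtain ⟨l, rfl⟩ := exists_map_eq (f := fun s : {s // P s} => f s.1) (l := rows) fun t ht => by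
    obtain ⟨s, hs, rfl⟩ := h t ht
    exact ⟨⟨s, hs⟩, rfl⟩
  refine ⟨l.map Subtype.val, fun s hs => ?_, by simp⟩
  obtain ⟨s, -, rfl⟩ := List.mem_map.1 hs
  exact s.2

/-- Each ingredient of `mix` respects linear identities: the threshold bits and the replacement by
fillers act entrywise, hence on assignments to the variables. Each column of a tagged relation has a
single tag, so preservation reduces to that of `f`; for the domain constraints this is
conservativity. -/
theorem LinearMaltsevCondition.conservativePolymorphisms_mix {M : LinearMaltsevCondition}
    {b f : Fin M.numSymbols → List ℕ → ℕ} {cs : List VarConstraint} {dm : Domains}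
    (hdm : (dm.map Prod.fst).Nodup) (hcs : ScopesIn cs dm) (hb : M.ConservativeOps 2 b)
    (hf : ∀ e ∈ dm, ∀ i, ∀ l : List ℕ, l.length = M.arity i → (∀ a ∈ l, a ∈ e.2) → f i l ∈ l)
    (hM : ∀ e ∈ dm, ∀ ι ∈ M.identities, ι.HoldsOn (· ∈ e.2) f)
    (hpres : ∀ c ∈ cs, ∀ i, ∀ rows : List (List ℕ), rows.length = M.arity i →
      (∀ t ∈ rows, t ∈ c.2 ∧ ∀ j < c.1.length, t.getD j 0 ∈ lookup dm (c.1.getD j [])) →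
      (columns c.1.length rows).map (f i) ∈ c.2) :
    M.ConservativePolymorphisms (taggedInstance cs dm) fun i => mix (b i) (f i) dm := by
  refine ⟨wellFormed_taggedInstance hcs, ⟨fun i l hl => ?_, fun ι hι => ?_⟩, ?_⟩
  · exact mix_mem hdm (hb.mem i) (fun e he => hf e he i) hl
  · have hb' := hb.holds ι hι
    have hρ : ∀ φ : ℕ → ℕ, (∀ n, φ n < (elements dm).length) → ∀ e ∈ dm, ∀ c ∈ e.2, ∀ n,
        (bif ((elements dm).getD (φ n) []).tail == e.1 then
          ((elements dm).getD (φ n) []).headD 0 else c) ∈ e.2 := by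
      intro φ hφ e he c hc n
      obtain ⟨e', he', a', ha', hw'⟩ := exists_getD_elements (hφ n)
      rw [hw']
      by_cases hee : e'.1 = e.1
      · rw [← eq_of_fst_eq hdm he' he hee]
        simpa using ha'
      · have : (e'.1 == e.1) = false := by simpa using hee
        simpa [this] using hc
    have hbit : ∀ (φ : ℕ → ℕ) (n m : ℕ), (bif decide (n < φ m) then 1 else 0) < 2 := by
      intro φ n m
      cases decide (n < φ m) <;> simp
    cases ι with
    | opOp i j x y =>
      intro φ hφ
      have hch : chain (b i) (elements dm).length (List.ofFn fun a => φ (x a)) =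
          chain (b j) (elements dm).length (List.ofFn fun a => φ (y a)) := by
        simp only [chain, List.map_ofFn]
        congr 1
        refine List.filter_congr fun n _ => ?_
        exact congrArg (· == 0) (hb' _ (hbit φ n))
      simp only [mix, hch]
      set v := ((elements dm).getD (chain (b j) (elements dm).length
        (List.ofFn fun a => φ (y a))) []).tail
      -- Both sides choose the same domain. Replacing foreign values by `c` turns `φ` into an
      -- assignment with values in that domain, where the identity holds for `f`.
      have hus : ((lookup dm v).map fun c => f i ((List.ofFn fun a => φ (x a)).map fun k =>
          bif ((elements dm).getD k []).tail == v then
            ((elements dm).getD k []).headD 0 else c)) =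
          (lookup dm v).map fun c => f j ((List.ofFn fun a => φ (y a)).map fun k =>
          bif ((elements dm).getD k []).tail == v then
            ((elements dm).getD k []).headD 0 else c) := by
        refine List.map_congr_left fun c hc => ?_
        obtain ⟨e, he, hev, hl⟩ := exists_of_mem_lookup hc
        rw [← hev]
        simp only [List.map_ofFn]
        exact hM e he _ hι _ (hρ φ hφ e he c (hl ▸ hc))
      simp only [hus]
    | opVar i x y =>
      intro φ hφ
      obtain ⟨e, he, a, ha, hw⟩ := exists_getD_elements (hφ y)
      -- By the identity for `b`, the result at threshold `n` is the bit of `n < φ y`, which is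
      -- first `0` at `n = φ y`.
      have hch : chain (b i) (elements dm).length (List.ofFn fun a => φ (x a)) = φ y := by
        refine chain_eq (hφ y) ?_ fun n hn => ?_
        · rw [List.map_ofFn]
          refine (hb' _ (hbit φ (φ y))).trans ?_
          simp
        · rw [List.map_ofFn]
          refine ne_of_eq_of_ne (hb' _ (hbit φ n)) ?_
          simp [hn]
      beta_reduce
      rw [mix_eq hdm he ha hch hw (u := a), ← hw, idxOf_getD (nodup_elements dm) _ (hφ y)]
      intro c hc
      rw [List.map_ofFn]
      refine (hM e he _ hι _ (hρ φ hφ e he c hc)).trans ?_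
      rw [hw]
      simp
  · intro c' hc' i rows hk hrows
    obtain ⟨c, hc, rfl⟩ := List.mem_map.1 hc'
    have hvars := (hcs.append_domainConstraints c hc).1
    have hpres' : ∀ rows : List (List ℕ), rows.length = M.arity i →
        (∀ t ∈ rows, t ∈ c.2 ∧ ∀ j < c.1.length, t.getD j 0 ∈ lookup dm (c.1.getD j [])) →
        (columns c.1.length rows).map (f i) ∈ c.2 := by
      rcases List.mem_append.1 hc with hc | hc
      · exact hpres c hc i
      · obtain ⟨e, he, rfl⟩ := List.mem_map.1 hc
        intro rows hk hrows
        have h0 : ∀ a ∈ rows.map (fun t => t.getD 0 0), a ∈ e.2 := by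
          intro a ha
          obtain ⟨t, ht, rfl⟩ := List.mem_map.1 ha
          have := (hrows t ht).2 0 (by simp [domainConstraint])
          simpa only [domainConstraint, List.getD_cons_zero, lookup_eq hdm he] using this
        have := h0 _ (hf e he i (rows.map fun t => t.getD 0 0) (by simpa using hk) h0)
        simpa [domainConstraint, columns] using this
    have hmemE : ∀ j < c.1.length, ∀ a, a :: c.1.getD j [] ∈ elements dm →
        a ∈ lookup dm (c.1.getD j []) := by
      intro j hj a ha
      obtain ⟨e, he, hev⟩ := List.mem_map.1 (hvars _ (getD_mem [] hj))
      rw [← hev, lookup_eq hdm he]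
      rw [← hev] at ha
      exact (cons_mem_elements hdm he).1 ha
    obtain ⟨rows, hrows', rfl⟩ := exists_rows_eq (P := fun t => t ∈ c.2 ∧
        ∀ w ∈ tagTuple c.1 t, w ∈ elements dm)
      (f := fun t => (tagTuple c.1 t).map fun w => List.idxOf w (elements dm)) (rows := rows) (by
        intro t ht
        obtain ⟨s, h1, h2, h3⟩ := mem_tagConstraint.1 (hrows t ht)
        exact ⟨s, ⟨h1, h2⟩, h3⟩)
    rw [List.length_map] at hk
    have htag : ∀ t ∈ rows, ∀ j < c.1.length, t.getD j 0 ∈ lookup dm (c.1.getD j []) :=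
      fun t ht j hj => hmemE j hj _ ((hrows' t ht).2 _
        (List.mem_map.2 ⟨j, by simpa using hj, rfl⟩))
    have hcol := hpres' rows hk fun t ht => ⟨(hrows' t ht).1, htag t ht⟩
    have hcolget : ∀ j < c.1.length, ((columns c.1.length rows).map (f i)).getD j 0 =
        f i (rows.map fun t => t.getD j 0) := by
      intro j hj
      rw [columns, List.map_map, getD_range_map _ hj]
      rfl
    refine mem_tagConstraint.2 ⟨_, hcol, ?_, ?_⟩
    · intro w hw
      obtain ⟨j, hj, rfl⟩ := List.mem_map.1 hw
      rw [List.mem_range] at hj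
      rw [hcolget j hj]
      obtain ⟨e, he, hev⟩ := List.mem_map.1 (hvars _ (getD_mem [] hj))
      have h0 : ∀ a ∈ rows.map (fun t => t.getD j 0), a ∈ e.2 := by
        intro a ha
        obtain ⟨t, ht, rfl⟩ := List.mem_map.1 ha
        rw [← lookup_eq hdm he, hev]
        exact htag t ht j hj
      rw [← hev]
      exact (cons_mem_elements hdm he).2 (h0 _ (hf e he i _ (by simpa using hk) h0))
    · have hlen : (tagConstraint dm c).1.length = c.1.length := by simp [tagConstraint]
      rw [hlen, tagTuple, List.map_map]
      conv_rhs => rw [columns, List.map_map]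
      refine List.map_congr_left fun j hj => ?_
      rw [List.mem_range] at hj
      simp only [Function.comp_apply]
      rw [hcolget j hj, List.map_map]
      obtain ⟨e, he, hev⟩ := List.mem_map.1 (hvars _ (getD_mem [] hj))
      rw [← hev, ← mix_column hdm (hb.mem i) he (x := rows.map fun t => t.getD j 0)
        (by simpa using hk)]
      · rw [List.map_map]
        congr 1
        refine List.map_congr_left fun t _ => ?_
        simp only [Function.comp_apply, tagTuple, List.map_map]
        rw [getD_range_map _ hj, hev]
        rfl
      · intro a ha
        obtain ⟨t, ht, rfl⟩ := List.mem_map.1 ha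
        rw [← lookup_eq hdm he, hev]
        exact htag t ht j hj

/-! ### The indicator problem -/

/-- A number greater than the names of all variables of the identity. -/
def LinearIdentity.varBound {m : ℕ} {arity : Fin m → ℕ} : LinearIdentity arity → ℕ
  | .opOp _ _ x y => Finset.univ.sup x + Finset.univ.sup y + 1
  | .opVar _ x y => Finset.univ.sup x + y + 1

/-- The constraint on the values of the operations which expresses an identity at one assignment
to its variables. -/
def LinearIdentity.constraintAt {m : ℕ} {arity : Fin m → ℕ} (d : ℕ) (φ : ℕ → ℕ) :
    LinearIdentity arity → VarConstraint
  | .opOp i j x y =>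
    ([(i : ℕ) :: List.ofFn fun a => φ (x a), (j : ℕ) :: List.ofFn fun b => φ (y b)],
      (List.range d).map fun a => [a, a])
  | .opVar i x y => ([(i : ℕ) :: List.ofFn fun a => φ (x a)], [[φ y]])

/-- The constraints on the values of the operations which express an identity. -/
def LinearIdentity.constraints {m : ℕ} {arity : Fin m → ℕ} (d : ℕ) (ι : LinearIdentity arity) :
    List VarConstraint :=
  (listsOf (List.range d) ι.varBound).map fun φ => ι.constraintAt d fun n => φ.getD n 0

/-- Variables with fixed values: each pair `(i :: π, p)` sends the
variable `i :: x`, where `x` lists the entries of `s` at the positions `π`, to the entry of `s` at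
the position `p`. -/
def patternDomains (g : List (List ℕ × ℕ)) (s : List ℕ) : Domains :=
  g.map fun e => (e.1.headD 0 :: e.1.tail.map fun p => s.getD p 0, [s.getD e.2 0])

/-- The entries of the argument tuple of the variable lie in one of the given lists. -/
def covered (Ss : List (List ℕ)) (v : List ℕ) : Bool :=
  Ss.any fun S => v.tail.all fun a => S.contains a

/-- The constraints all of whose variables are covered. -/
def restrict (Ss : List (List ℕ)) (cs : List VarConstraint) : List VarConstraint :=
  cs.filter fun c => c.1.all fun v => covered Ss v

/-- Values of the variables at the beginning of a search. -/
def startDomain (Ss : List (List ℕ)) (fx : Domains) (v : List ℕ) : List ℕ :=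
  bif (lookup fx v).isEmpty then (bif covered Ss v then v.tail else [v.tail.headD 0])
  else lookup fx v

/-- The value of a variable, if only one value is left. -/
def value (T : Domains) (v : List ℕ) : ℕ := (lookup T v).headD 0

/-- Replace the domain of the variable `v` by `{a}`. -/
def setValue (dm : Domains) (v : List ℕ) (a : ℕ) : Domains :=
  dm.map fun e => (e.1, bif e.1 == v then [a] else e.2)

/-- The constraints have a solution within the given domains. -/
def Solvable (cs : List VarConstraint) (dm : Domains) : Prop := ∃ ψ, IsSolution cs dm ψ

open Classical in
/-- The first of the given domain systems in which the constraints have a solution. -/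
noncomputable def firstSolvable (cs : List VarConstraint) (dms : List Domains) : Domains :=
  (dms.filter fun dm => decide (Solvable cs dm)).headD []

/-- Fix the value of the variable `v`. -/
noncomputable def narrow (cs : List VarConstraint) (dm : Domains) (v : List ℕ) : Domains :=
  firstSolvable cs ((lookup dm v).map fun a => setValue dm v a)

namespace LinearMaltsevCondition

variable (M : LinearMaltsevCondition)

/-- The variables of the indicator problem: `i :: x` stands for the value of the operation `i` at
the tuple `x`. -/
def vars (d : ℕ) : List (List ℕ) :=
  nub ((List.finRange M.numSymbols).flatMap fun i =>
    (listsOf (List.range d) (M.arity i)).map fun x => (i : ℕ) :: x)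

/-- Every variable together with the values given by `δ`. -/
def assign (d : ℕ) (δ : List ℕ → List ℕ) : Domains := (M.vars d).map fun v => (v, δ v)

/-- The constraints which express that a relation is preserved. -/
def preservationConstraints (c : ListConstraint) : List VarConstraint :=
  (List.finRange M.numSymbols).flatMap fun i => (listsOf c.2 (M.arity i)).map fun rows =>
    ((columns c.1.length rows).map fun x => (i : ℕ) :: x, c.2)

/-- The constraints of the indicator problem. -/
noncomputable def indicator (L : ListInstance) : List VarConstraint :=
  (L.2.2.flatMap fun c => M.preservationConstraints c) ++
    M.identities.toList.flatMap fun ι => ι.constraints L.2.1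

/-- All ways to choose a position for every tuple of positions. -/
def patterns : List (List (List ℕ × ℕ)) :=
  List.sections ((M.vars (Finset.univ.sup M.arity)).map fun v =>
    v.tail.map fun p => (v, p))

/-- The domain systems with which the search for the values on `s` begins. -/
def startDomains (d : ℕ) (Ss : List (List ℕ)) (s : List ℕ) : List Domains :=
  M.patterns.map fun g => M.assign d fun v => startDomain Ss (patternDomains g s) v

/-- One step of the algorithm: a solution of the constraints covered by `Ss` is replaced by one
of the constraints covered by `s :: Ss`. -/
noncomputable def extend (L : ListInstance) (σ : List (List ℕ) × Domains) (s : List ℕ) :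
    List (List ℕ) × Domains :=
  (s :: σ.1, (M.vars L.2.1).foldl
    (fun dm v => narrow (restrict (s :: σ.1) (M.indicator L)) dm v)
    (firstSolvable (restrict (s :: σ.1) (M.indicator L)) (M.startDomains L.2.1 σ.1 s)))

/-- The state of the algorithm at the beginning. -/
def initialState (d : ℕ) : List (List ℕ) × Domains :=
  ((List.range d).map fun a => [a], M.assign d fun v => [v.tail.headD 0])

/-- The operations given by a table. -/
def opsOfTable (T : Domains) (i : Fin M.numSymbols) (x : List ℕ) : ℕ := value T ((i : ℕ) :: x)

end LinearMaltsevCondition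

/-! ### The parts of the algorithm run in polynomial time -/

namespace PolyTime

variable {α β : Type} [Enc α] [Enc β]

@[fun_prop]
theorem lookup {f : α → Domains} {g : α → List ℕ} (hf : PolyTime f) (hg : PolyTime g) :
    PolyTime fun a => lookup (f a) (g a) := by
  unfold ConsCSP.lookup
  fun_prop

@[fun_prop]
theorem value {f : α → Domains} {g : α → List ℕ} (hf : PolyTime f) (hg : PolyTime g) :
    PolyTime fun a => value (f a) (g a) := by
  unfold ConsCSP.value
  fun_prop

@[fun_prop]
theorem elements : PolyTime elements := by
  unfold ConsCSP.elements
  fun_prop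

@[fun_prop]
theorem tagTuple {f : α → List (List ℕ)} {g : α → List ℕ} (hf : PolyTime f) (hg : PolyTime g) :
    PolyTime fun a => tagTuple (f a) (g a) := by
  unfold ConsCSP.tagTuple
  fun_prop

@[fun_prop]
theorem tagConstraint {f : α → Domains} {g : α → VarConstraint} (hf : PolyTime f)
    (hg : PolyTime g) : PolyTime fun a => tagConstraint (f a) (g a) := by
  unfold ConsCSP.tagConstraint
  fun_prop

@[fun_prop]
theorem domainConstraint : PolyTime domainConstraint := by
  unfold ConsCSP.domainConstraint
  fun_prop

@[fun_prop]
theorem taggedInstance {f : α → List VarConstraint} {g : α → Domains} (hf : PolyTime f)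
    (hg : PolyTime g) : PolyTime fun a => taggedInstance (f a) (g a) := by
  unfold ConsCSP.taggedInstance
  fun_prop

theorem chain {b : List ℕ → ℕ} (hb : PolyTime b) {e : α → ℕ} {ns : α → List ℕ}
    (he : PolyTime e) (hns : PolyTime ns) : PolyTime fun a => chain b (e a) (ns a) := by
  unfold ConsCSP.chain
  fun_prop

theorem mix {b : List ℕ → ℕ} (hb : PolyTime b) {f : α → List ℕ → ℕ}
    (hf : PolyTime fun x : α × List ℕ => f x.1 x.2) {dm : α → Domains} {ns : α → List ℕ}
    (hdm : PolyTime dm) (hns : PolyTime ns) :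
    PolyTime fun a => mix b (f a) (dm a) (ns a) := by
  have hn : PolyTime fun a => ConsCSP.chain b (ConsCSP.elements (dm a)).length (ns a) :=
    chain hb (by fun_prop) hns
  have hx : PolyTime fun x : (α × ℕ) × ℕ => (ns x.1.1).map fun k =>
      bif ((ConsCSP.elements (dm x.1.1)).getD k []).tail ==
        ((ConsCSP.elements (dm x.1.1)).getD x.1.2 []).tail then
        ((ConsCSP.elements (dm x.1.1)).getD k []).headD 0 else x.2 := by fun_prop
  have hx' : PolyTime fun x : (α × ℕ) × ℕ => x.1.1 := by fun_prop
  have hus := list_map (l := fun y : α × ℕ => ConsCSP.lookup (dm y.1)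
    ((ConsCSP.elements (dm y.1)).getD y.2 []).tail) (f := fun y c => f y.1 ((ns y.1).map fun k =>
      bif ((ConsCSP.elements (dm y.1)).getD k []).tail ==
        ((ConsCSP.elements (dm y.1)).getD y.2 []).tail then
        ((ConsCSP.elements (dm y.1)).getD k []).headD 0 else c)) (hf.comp (pair hx' hx))
    (by fun_prop)
  have hfin : ∀ us : α × ℕ → List ℕ, PolyTime us → PolyTime fun y : α × ℕ =>
      bif (us y).all fun u => u == (us y).headD 0 then
        List.idxOf ((us y).headD 0 :: ((ConsCSP.elements (dm y.1)).getD y.2 []).tail)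
          (ConsCSP.elements (dm y.1)) else y.2 := by
    intro us hus
    fun_prop
  exact (hfin _ hus).comp (pair id hn)

@[fun_prop]
theorem listOfFn {k : ℕ} {f : Fin k → α → β} (hf : ∀ i, PolyTime (f i)) :
    PolyTime fun a => List.ofFn fun i => f i a := by
  simp only [List.ofFn_eq_map]
  exact list_map_const _ hf

@[fun_prop]
theorem columns {r : α → ℕ} {rows : α → List (List ℕ)} (hr : PolyTime r)
    (hrows : PolyTime rows) : PolyTime fun a => columns (r a) (rows a) := by
  unfold ConsCSP.columns
  fun_prop

@[fun_prop]
theorem covered {f : α → List (List ℕ)} {g : α → List ℕ} (hf : PolyTime f) (hg : PolyTime g) :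
    PolyTime fun a => covered (f a) (g a) := by
  unfold ConsCSP.covered
  fun_prop

@[fun_prop]
theorem restrict {f : α → List (List ℕ)} {g : α → List VarConstraint} (hf : PolyTime f)
    (hg : PolyTime g) : PolyTime fun a => restrict (f a) (g a) := by
  unfold ConsCSP.restrict
  fun_prop

@[fun_prop]
theorem setValue {f : α → Domains} {g : α → List ℕ} {h : α → ℕ} (hf : PolyTime f)
    (hg : PolyTime g) (hh : PolyTime h) : PolyTime fun a => setValue (f a) (g a) (h a) := by
  unfold ConsCSP.setValue
  fun_prop

@[fun_prop]
theorem patternDomains {f : α → List (List ℕ × ℕ)} {g : α → List ℕ} (hf : PolyTime f)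
    (hg : PolyTime g) : PolyTime fun a => patternDomains (f a) (g a) := by
  unfold ConsCSP.patternDomains
  fun_prop

@[fun_prop]
theorem startDomain {f : α → List (List ℕ)} {g : α → Domains} {h : α → List ℕ}
    (hf : PolyTime f) (hg : PolyTime g) (hh : PolyTime h) :
    PolyTime fun a => startDomain (f a) (g a) (h a) := by
  unfold ConsCSP.startDomain
  fun_prop

/-- The identity is fixed, so the tuples of values for its variables have constant length and there
are polynomially many of them. -/
theorem identityConstraints {m : ℕ} {arity : Fin m → ℕ} (ι : LinearIdentity arity) :
    PolyTime fun d : ℕ => ι.constraints d := by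
  cases ι with
  | opOp i j x y =>
    have h1 : PolyTime fun x' : ℕ × List ℕ => List.ofFn fun a => x'.2.getD (x a) 0 :=
      listOfFn fun a => by fun_prop
    have h2 : PolyTime fun x' : ℕ × List ℕ => List.ofFn fun a => x'.2.getD (y a) 0 :=
      listOfFn fun a => by fun_prop
    unfold LinearIdentity.constraints LinearIdentity.constraintAt
    fun_prop
  | opVar i x y =>
    have h1 : PolyTime fun x' : ℕ × List ℕ => List.ofFn fun a => x'.2.getD (x a) 0 :=
      listOfFn fun a => by fun_prop
    unfold LinearIdentity.constraints LinearIdentity.constraintAt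
    fun_prop

variable (M : LinearMaltsevCondition)

@[fun_prop]
theorem vars : PolyTime M.vars :=
  nub.comp (list_flatMap_const _ fun i => by fun_prop)

@[fun_prop]
theorem assign {f : α → ℕ} {δ : α → List ℕ → List ℕ} (hf : PolyTime f)
    (hδ : PolyTime fun x : α × List ℕ => δ x.1 x.2) :
    PolyTime fun a => M.assign (f a) (δ a) := by
  unfold LinearMaltsevCondition.assign
  fun_prop

@[fun_prop]
theorem indicator : PolyTime M.indicator := by
  have h1 : PolyTime fun c => M.preservationConstraints c :=
    list_flatMap_const _ fun i => by fun_prop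
  have h2 : PolyTime fun L : ListInstance =>
      M.identities.toList.flatMap fun ι => ι.constraints L.2.1 :=
    list_flatMap_const _ fun ι => (identityConstraints ι).comp (by fun_prop)
  unfold LinearMaltsevCondition.indicator
  fun_prop

@[fun_prop]
theorem startDomains {d : α → ℕ} {Ss : α → List (List ℕ)} {s : α → List ℕ} (hd : PolyTime d)
    (hSs : PolyTime Ss) (hs : PolyTime s) :
    PolyTime fun a => M.startDomains (d a) (Ss a) (s a) := by
  unfold LinearMaltsevCondition.startDomains
  fun_prop

@[fun_prop]
theorem initialState : PolyTime M.initialState := by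
  unfold LinearMaltsevCondition.initialState
  fun_prop

theorem tables {d : α → ℕ} (hd : PolyTime d) {F : α → Fin M.numSymbols → List ℕ → ℕ}
    (hF : ∀ i, PolyTime fun x : α × List ℕ => F x.1 i x.2) :
    PolyTime fun a => M.tables (d a) (F a) :=
  list_map_const _ fun i => by
    have := hF i
    fun_prop

end PolyTime

/-! ### Correctness of the algorithm -/

theorem covered_iff {Ss : List (List ℕ)} {v : List ℕ} :
    covered Ss v = true ↔ ∃ S ∈ Ss, ∀ a ∈ v.tail, a ∈ S := by
  simp [covered]

theorem LinearIdentity.mem_constraints {m : ℕ} {arity : Fin m → ℕ} {d : ℕ}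
    {ι : LinearIdentity arity} {c : VarConstraint} :
    c ∈ ι.constraints d ↔ ∃ φ : ℕ → ℕ, (∀ n, φ n < d) ∧ ι.constraintAt d φ = c := by
  have hpos : 0 < ι.varBound := by cases ι <;> simp [varBound]
  constructor
  · intro h
    obtain ⟨φ, hφ, rfl⟩ := List.mem_map.1 h
    obtain ⟨h1, h2⟩ := mem_listsOf.1 hφ
    refine ⟨_, fun n => ?_, rfl⟩
    have h3 : ∀ n, n < φ.length → φ.getD n 0 < d := fun n hn =>
      List.mem_range.1 (h2 _ (getD_mem 0 hn))
    by_cases hn : n < φ.length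
    · exact h3 n hn
    · rw [List.getD_eq_default _ _ (by omega)]
      exact (Nat.zero_le _).trans_lt (h3 0 (by omega))
  · rintro ⟨φ, hφ, rfl⟩
    refine List.mem_map.2 ⟨(List.range ι.varBound).map φ, mem_listsOf.2 ⟨by simp, ?_⟩, ?_⟩
    · simpa using fun n _ => hφ n
    · have h : ∀ n < ι.varBound, ((List.range ι.varBound).map φ).getD n 0 = φ n :=
        fun n hn => getD_range_map φ hn 0
      cases ι with
      | opOp i j x y =>
        have hx : ∀ a, x a < varBound (.opOp i j x y) := fun a => by
          have := Finset.le_sup (f := x) (Finset.mem_univ a)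
          simp only [varBound]
          omega
        have hy : ∀ a, y a < varBound (.opOp i j x y) := fun a => by
          have := Finset.le_sup (f := y) (Finset.mem_univ a)
          simp only [varBound]
          omega
        simp only [constraintAt, h _ (hx _), h _ (hy _)]
      | opVar i x y =>
        have hx : ∀ a, x a < varBound (.opVar i x y) := fun a => by
          have := Finset.le_sup (f := x) (Finset.mem_univ a)
          simp only [varBound]
          omega
        have hy : y < varBound (.opVar i x y) := by
          simp only [varBound]
          omega
        simp only [constraintAt, h _ (hx _), h _ hy]

theorem isTuple_ofFn {d k : ℕ} {f : Fin k → ℕ} (h : ∀ i, f i < d) :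
    IsTuple d k (List.ofFn f) := by
  refine ⟨by simp, fun a ha => ?_⟩
  obtain ⟨i, rfl⟩ := (List.mem_ofFn' _ _).1 ha
  exact h i

theorem LinearIdentity.of_mem_constraintAt {m : ℕ} {arity : Fin m → ℕ} {d : ℕ} {φ : ℕ → ℕ}
    (hφ : ∀ n, φ n < d) {ι : LinearIdentity arity} {v : List ℕ}
    (hv : v ∈ (ι.constraintAt d φ).1) :
    ∃ (i : Fin m) (x : List ℕ), IsTuple d (arity i) x ∧ (i : ℕ) :: x = v ∧
      ∀ a ∈ x, ∃ n, φ n = a := by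
  have h : ∀ (i : Fin m) (x : Fin (arity i) → ℕ), v = (i : ℕ) :: List.ofFn (fun a => φ (x a)) →
      ∃ (i : Fin m) (x : List ℕ), IsTuple d (arity i) x ∧ (i : ℕ) :: x = v ∧
        ∀ a ∈ x, ∃ n, φ n = a := by
    rintro i x rfl
    refine ⟨i, _, isTuple_ofFn fun _ => hφ _, rfl, fun a ha => ?_⟩
    obtain ⟨k, rfl⟩ := (List.mem_ofFn' _ _).1 ha
    exact ⟨_, rfl⟩
  cases ι with
  | opOp i j x y =>
    simp only [constraintAt, List.mem_cons, List.not_mem_nil, or_false] at hv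
    exact hv.elim (h i x) (h j y)
  | opVar i x y =>
    simp only [constraintAt, List.mem_cons, List.not_mem_nil, or_false] at hv
    exact h i x hv

theorem LinearIdentity.holdsOn_of_constraintAt {m : ℕ} {arity : Fin m → ℕ} {d : ℕ}
    {S : ℕ → Prop} {ψ : List ℕ → ℕ} {ι : LinearIdentity arity}
    (h : ∀ φ : ℕ → ℕ, (∀ n, S (φ n)) → (ι.constraintAt d φ).1.map ψ ∈ (ι.constraintAt d φ).2) :
    ι.HoldsOn S fun i x => ψ ((i : ℕ) :: x) := by
  cases ι with
  | opOp i j x y =>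
    intro φ hφ
    obtain ⟨a, -, ha⟩ := List.mem_map.1 (h φ hφ)
    simp only [constraintAt, List.map_cons, List.map_nil, List.cons.injEq, and_true] at ha
    exact ha.1.symm.trans ha.2
  | opVar i x y =>
    intro φ hφ
    have := h φ hφ
    simpa [constraintAt] using this

namespace LinearMaltsevCondition

variable {M : LinearMaltsevCondition}

theorem mem_vars {d : ℕ} {v : List ℕ} :
    v ∈ M.vars d ↔ ∃ (i : Fin M.numSymbols) (x : List ℕ), IsTuple d (M.arity i) x ∧
      (i : ℕ) :: x = v := by
  simp [vars, mem_nub, mem_listsOf, IsTuple]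

theorem lt_of_mem_vars {d : ℕ} {v : List ℕ} (hv : v ∈ M.vars d) {a : ℕ} (ha : a ∈ v.tail) :
    a < d := by
  obtain ⟨i, x, hx, rfl⟩ := mem_vars.1 hv
  exact hx.2 a ha

theorem fst_assign (d : ℕ) (δ : List ℕ → List ℕ) : (M.assign d δ).map Prod.fst = M.vars d := by
  simp [assign, Function.comp_def]

theorem nodup_assign (d : ℕ) (δ : List ℕ → List ℕ) : ((M.assign d δ).map Prod.fst).Nodup := by
  rw [fst_assign]
  exact nodup_nub _

theorem lookup_assign {d : ℕ} (δ : List ℕ → List ℕ) {v : List ℕ} (hv : v ∈ M.vars d) :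
    lookup (M.assign d δ) v = δ v :=
  lookup_eq (nodup_assign d δ) (e := (v, δ v)) (List.mem_map.2 ⟨v, hv, rfl⟩)

/-- Used with `ε v = v.tail` to bound every domain system met during the search, independently of
the number of steps made. -/
theorem esize_assign_le {d : ℕ} {δ ε : List ℕ → List ℕ}
    (h : ∀ v ∈ M.vars d, (δ v).Sublist (ε v)) : esize (M.assign d δ) ≤ esize (M.assign d ε) := by
  unfold assign
  revert h
  generalize M.vars d = l
  intro h
  induction l with
  | nil => rfl
  | cons v l ih =>
    have h1 := ih fun v hv => h v (List.mem_cons_of_mem _ hv)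
    have h2 := esize_le_of_sublist (h v (by simp))
    simp only [List.map_cons, esize_list_cons, esize_pair]
    omega

theorem mem_indicator {L : ListInstance} {c : VarConstraint} :
    c ∈ M.indicator L ↔ (∃ c' ∈ L.2.2, ∃ (i : Fin M.numSymbols) (rows : List (List ℕ)),
      rows.length = M.arity i ∧ (∀ t ∈ rows, t ∈ c'.2) ∧
        ((columns c'.1.length rows).map (fun x => (i : ℕ) :: x), c'.2) = c) ∨
      ∃ ι ∈ M.identities, ∃ φ : ℕ → ℕ, (∀ n, φ n < L.2.1) ∧ ι.constraintAt L.2.1 φ = c := by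
  simp [indicator, preservationConstraints, mem_listsOf, LinearIdentity.mem_constraints,
    and_assoc]

/-- A nullary operation cannot be conservative: its value would be a member of the empty list. -/
theorem ConservativeOps.arity_pos {d : ℕ} {F : Fin M.numSymbols → List ℕ → ℕ}
    (h : M.ConservativeOps d F) (i : Fin M.numSymbols) : 0 < M.arity i := by
  by_contra h0
  have := h.mem i [] ⟨by simp; omega, by simp⟩
  simp at this

theorem isTuple_column {d r k j : ℕ} {rel rows : List (List ℕ)}
    (hrel : ∀ t ∈ rel, IsTuple d r t) (hk : rows.length = k) (hrows : ∀ t ∈ rows, t ∈ rel)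
    (hj : j < r) : IsTuple d k (rows.map fun t => t.getD j 0) := by
  refine ⟨by simpa using hk, fun a ha => ?_⟩
  obtain ⟨t, ht, rfl⟩ := List.mem_map.1 ha
  obtain ⟨h1, h2⟩ := hrel t (hrows t ht)
  exact h2 _ (getD_mem 0 (h1 ▸ hj))

theorem indicator_scopes {L : ListInstance} (hL : L.WellFormed) {c : VarConstraint}
    (hc : c ∈ M.indicator L) :
    (∀ v ∈ c.1, v ∈ M.vars L.2.1) ∧ ∀ t ∈ c.2, t.length = c.1.length := by
  rcases mem_indicator.1 hc with ⟨c', hc', i, rows, hk, hrows, rfl⟩ | ⟨ι, hι, φ, hφ, rfl⟩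
  · constructor
    · intro v hv
      obtain ⟨x, hx, rfl⟩ := List.mem_map.1 hv
      obtain ⟨j, hj, rfl⟩ := List.mem_map.1 hx
      exact mem_vars.2 ⟨i, _, isTuple_column (hL c' hc').2 hk hrows (List.mem_range.1 hj), rfl⟩
    · intro t ht
      simpa [columns] using ((hL c' hc').2 t ht).1
  · constructor
    · intro v hv
      obtain ⟨i, x, hx, h, -⟩ := LinearIdentity.of_mem_constraintAt hφ hv
      exact mem_vars.2 ⟨i, x, hx, h⟩
    · cases ι with
      | opOp i j x y => simp [LinearIdentity.constraintAt]
      | opVar i x y => simp [LinearIdentity.constraintAt]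

variable (M) in
/-- The assignment `ψ` is conservative and satisfies the covered constraints of the indicator
problem. -/
structure PartialSolution (L : ListInstance) (Ss : List (List ℕ)) (ψ : List ℕ → ℕ) : Prop where
  mem : ∀ v ∈ M.vars L.2.1, ψ v ∈ v.tail
  sat : ∀ c ∈ M.indicator L, (∀ v ∈ c.1, covered Ss v = true) → c.1.map ψ ∈ c.2

variable (M) in
/-- The domains consist of entries of the argument tuples, and each lies in one of the given
lists. -/
def Admissible (d : ℕ) (Ss : List (List ℕ)) (dm : Domains) : Prop :=
  ∃ δ, dm = M.assign d δ ∧ ∀ v ∈ M.vars d, (δ v).Sublist v.tail ∧ ∃ S ∈ Ss, ∀ a ∈ δ v, a ∈ S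

/-- The values of given operations as an assignment to the variables of the indicator problem. -/
def evalVar (F : Fin M.numSymbols → List ℕ → ℕ) (v : List ℕ) : ℕ :=
  if h : v.headD 0 < M.numSymbols then F ⟨v.headD 0, h⟩ v.tail else 0

@[simp] theorem evalVar_cons (F : Fin M.numSymbols → List ℕ → ℕ) (i : Fin M.numSymbols)
    (x : List ℕ) : evalVar F ((i : ℕ) :: x) = F i x := by
  simp [evalVar]

theorem ConservativePolymorphisms.partialSolution {L : ListInstance}
    {F : Fin M.numSymbols → List ℕ → ℕ} (h : M.ConservativePolymorphisms L F)
    (Ss : List (List ℕ)) : M.PartialSolution L Ss (evalVar F) := by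
  constructor
  · intro v hv
    obtain ⟨i, x, hx, rfl⟩ := mem_vars.1 hv
    rw [evalVar_cons]
    exact h.ops.mem i x hx
  · intro c hc _
    rcases mem_indicator.1 hc with ⟨c', hc', i, rows, hk, hrows, rfl⟩ | ⟨ι, hι, φ, hφ, rfl⟩
    · simpa [Function.comp_def] using h.preserves c' hc' i rows hk hrows
    · have := h.ops.holds ι hι
      cases ι with
      | opOp i j x y =>
        have h1 := isTuple_ofFn (f := fun a => φ (x a)) fun a => hφ _
        have h2 := h1.2 _ (h.ops.mem i _ h1)
        simp only [LinearIdentity.constraintAt, List.map_cons, evalVar_cons, List.map_nil]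
        rw [← this φ hφ]
        exact List.mem_map.2 ⟨_, List.mem_range.2 h2, rfl⟩
      | opVar i x y =>
        simp only [LinearIdentity.constraintAt, List.map_cons, evalVar_cons, List.map_nil]
        rw [this φ hφ]
        simp

namespace PartialSolution

variable {L : ListInstance} {Ss : List (List ℕ)} {ψ : List ℕ → ℕ}

theorem preserves (h : M.PartialSolution L Ss ψ) {c : ListConstraint} (hc : c ∈ L.2.2)
    {i : Fin M.numSymbols} {rows : List (List ℕ)} (hk : rows.length = M.arity i)
    (hrows : ∀ t ∈ rows, t ∈ c.2)
    (hcov : ∀ j < c.1.length, ∃ S ∈ Ss, ∀ t ∈ rows, t.getD j 0 ∈ S) :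
    ((columns c.1.length rows).map fun x => ψ ((i : ℕ) :: x)) ∈ c.2 := by
  have := h.sat _ (mem_indicator.2 (Or.inl ⟨c, hc, i, rows, hk, hrows, rfl⟩)) (by
    intro v hv
    obtain ⟨x, hx, rfl⟩ := List.mem_map.1 hv
    obtain ⟨j, hj, rfl⟩ := List.mem_map.1 hx
    obtain ⟨S, hS, hj⟩ := hcov j (List.mem_range.1 hj)
    refine covered_iff.2 ⟨S, hS, fun a ha => ?_⟩
    obtain ⟨t, ht, rfl⟩ := List.mem_map.1 ha
    exact hj t ht)
  simpa [Function.comp_def] using this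

/-- A solution of all constraints gives polymorphisms. -/
theorem conservativePolymorphisms (h : M.PartialSolution L Ss ψ) (hL : L.WellFormed)
    (hcov : ∀ v ∈ M.vars L.2.1, covered Ss v = true) :
    M.ConservativePolymorphisms L fun i x => ψ ((i : ℕ) :: x) := by
  refine ⟨hL, ⟨fun i l hl => h.mem _ (mem_vars.2 ⟨i, l, hl, rfl⟩), fun ι hι => ?_⟩, ?_⟩
  · refine LinearIdentity.holdsOn_of_constraintAt (d := L.2.1) fun φ hφ => ?_
    have hc := mem_indicator.2 (Or.inr ⟨ι, hι, φ, hφ, rfl⟩)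
    exact h.sat _ hc fun v hv => hcov v ((indicator_scopes hL hc).1 v hv)
  · intro c hc i rows hk hrows
    have hc' := mem_indicator.2 (Or.inl ⟨c, hc, i, rows, hk, hrows, rfl⟩)
    have := h.sat _ hc' fun v hv => hcov v ((indicator_scopes hL hc').1 v hv)
    simpa [Function.comp_def] using this

theorem scopesIn (hL : L.WellFormed) {cs : List VarConstraint}
    (hcs : ∀ c ∈ cs, c ∈ M.indicator L) (δ : List ℕ → List ℕ) :
    ScopesIn cs (M.assign L.2.1 δ) := by
  intro c hc
  rw [fst_assign]
  exact indicator_scopes hL (hcs c hc)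

/-- Instances with admissible domains can be solved with the help of a partial solution. -/
theorem conservativePolymorphisms_mix (h : M.PartialSolution L Ss ψ) (hL : L.WellFormed)
    {b : Fin M.numSymbols → List ℕ → ℕ} (hb : M.ConservativeOps 2 b) {dm : Domains}
    (hdm : M.Admissible L.2.1 Ss dm) {cs : List VarConstraint}
    (hcs : ∀ c ∈ cs, c ∈ M.indicator L) :
    M.ConservativePolymorphisms (taggedInstance cs dm)
      fun i => mix (b i) (fun x => ψ ((i : ℕ) :: x)) dm := by
  obtain ⟨δ, rfl, hδ⟩ := hdm
  have hlt : ∀ e ∈ M.assign L.2.1 δ, ∀ a ∈ e.2, a < L.2.1 := by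
    intro e he a ha
    obtain ⟨v, hv, rfl⟩ := List.mem_map.1 he
    exact lt_of_mem_vars hv ((hδ v hv).1.subset ha)
  refine LinearMaltsevCondition.conservativePolymorphisms_mix (f := fun i x => ψ ((i : ℕ) :: x))
    (nodup_assign _ _) (scopesIn hL hcs δ) hb ?_ ?_ ?_
  · intro e he i l hl hle
    exact h.mem _ (mem_vars.2 ⟨i, l, ⟨hl, fun a ha => hlt e he a (hle a ha)⟩, rfl⟩)
  -- An assignment with values in the domain `e.2` has them in one member of `Ss`, so the indicator
  -- constraint for the identity at this assignment is covered and `ψ` satisfies it.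
  · intro e he ι hι
    refine LinearIdentity.holdsOn_of_constraintAt (d := L.2.1) fun φ hφ => ?_
    have hφ' : ∀ n, φ n < L.2.1 := fun n => hlt e he _ (hφ n)
    refine h.sat _ (mem_indicator.2 (Or.inr ⟨ι, hι, φ, hφ', rfl⟩)) fun v hv => ?_
    obtain ⟨i, x, -, rfl, hx⟩ := LinearIdentity.of_mem_constraintAt hφ' hv
    obtain ⟨w, hw, rfl⟩ := List.mem_map.1 he
    obtain ⟨S, hS, hwS⟩ := (hδ w hw).2
    refine covered_iff.2 ⟨S, hS, fun a ha => ?_⟩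
    obtain ⟨n, rfl⟩ := hx a ha
    exact hwS _ (hφ n)
  · intro c hc i rows hk hrows
    have hscope := (indicator_scopes hL (hcs c hc)).1
    -- The `j`-th entries of the rows come from the domain of the `j`-th scope variable, so every
    -- column lies in a member of `Ss`. This makes the preservation constraint for these rows a
    -- covered one.
    have hcol : ∀ j < c.1.length, ∃ S ∈ Ss, ∀ t ∈ rows, t.getD j 0 ∈ S ∧ t.getD j 0 < L.2.1 := by
      intro j hj
      have hv := hscope _ (getD_mem [] hj)
      obtain ⟨S, hS, hvS⟩ := (hδ _ hv).2
      refine ⟨S, hS, fun t ht => ?_⟩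
      have := (hrows t ht).2 j hj
      rw [lookup_assign _ hv] at this
      exact ⟨hvS _ this, lt_of_mem_vars hv ((hδ _ hv).1.subset this)⟩
    have hmem : ∀ j < c.1.length, ψ ((i : ℕ) :: rows.map fun t => t.getD j 0) ∈
        rows.map fun t => t.getD j 0 := by
      intro j hj
      obtain ⟨S, -, h'⟩ := hcol j hj
      refine h.mem _ (mem_vars.2 ⟨i, _, ⟨by simpa using hk, fun a ha => ?_⟩, rfl⟩)
      obtain ⟨t, ht, rfl⟩ := List.mem_map.1 ha
      exact (h' t ht).2
    rcases mem_indicator.1 (hcs c hc) with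
      ⟨c', hc', i', rows', hk', hrows', rfl⟩ | ⟨ι, hι, φ, hφ, rfl⟩
    · have hlen : ((columns c'.1.length rows').map fun x => (i' : ℕ) :: x).length =
          c'.1.length := by simp [columns]
      simp only [hlen] at hcol ⊢
      refine h.preserves hc' hk (fun t ht => (hrows t ht).1) fun j hj => ?_
      obtain ⟨S, hS, h'⟩ := hcol j hj
      exact ⟨S, hS, fun t ht => (h' t ht).1⟩
    -- The relations expressing identities are subsets of the diagonal or single values. There
    -- conservativity alone makes the result equal to one of the rows.
    · cases ι with
      | opOp i₁ i₂ x y =>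
        have h0 := hmem 0 (by simp [LinearIdentity.constraintAt])
        obtain ⟨t, ht, hψ⟩ := List.mem_map.1 h0
        have hdiag : ∀ t ∈ rows, t.getD 1 0 = t.getD 0 0 := by
          intro t ht
          obtain ⟨a, -, rfl⟩ := List.mem_map.1 (hrows t ht).1
          rfl
        have h1 : (rows.map fun t => t.getD 1 0) = rows.map fun t => t.getD 0 0 :=
          List.map_congr_left hdiag
        have h2 : columns (LinearIdentity.constraintAt L.2.1 φ (.opOp i₁ i₂ x y)).1.length rows =
            [rows.map fun t => t.getD 0 0, rows.map fun t => t.getD 1 0] := rfl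
        rw [h2, h1, List.map_cons, List.map_cons, List.map_nil, ← hψ]
        obtain ⟨a, ha, rfl⟩ := List.mem_map.1 (hrows t ht).1
        exact List.mem_map.2 ⟨a, ha, rfl⟩
      | opVar i₁ x y =>
        have h0 := hmem 0 (by simp [LinearIdentity.constraintAt])
        obtain ⟨t, ht, hψ⟩ := List.mem_map.1 h0
        have h2 : columns (LinearIdentity.constraintAt L.2.1 φ (.opVar i₁ x y)).1.length rows =
            [rows.map fun t => t.getD 0 0] := rfl
        rw [h2, List.map_cons, List.map_nil, ← hψ]
        have h3 := (hrows t ht).1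
        simp only [LinearIdentity.constraintAt, List.mem_singleton] at h3 ⊢
        rw [h3]
        rfl

end PartialSolution

end LinearMaltsevCondition

/-! ### The search -/

theorem firstSolvable_spec {cs : List VarConstraint} {dms : List Domains}
    (h : ∃ dm ∈ dms, Solvable cs dm) :
    firstSolvable cs dms ∈ dms ∧ Solvable cs (firstSolvable cs dms) := by
  classical
  obtain ⟨dm, hdm, hs⟩ := h
  have hmem : dm ∈ dms.filter fun dm => decide (Solvable cs dm) :=
    List.mem_filter.2 ⟨hdm, by simpa using hs⟩
  have : firstSolvable cs dms ∈ dms.filter fun dm => decide (Solvable cs dm) := by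
    unfold firstSolvable
    cases h : dms.filter fun dm => decide (Solvable cs dm) with
    | nil => simp [h] at hmem
    | cons e l => simp
  simpa using List.mem_filter.1 this

namespace LinearMaltsevCondition

variable {M : LinearMaltsevCondition} {L : ListInstance} {d : ℕ} {Ss : List (List ℕ)}
  {cs : List VarConstraint}

theorem setValue_assign (δ : List ℕ → List ℕ) (v : List ℕ) (a : ℕ) :
    setValue (M.assign d δ) v a = M.assign d fun w => bif w == v then [a] else δ w := by
  simp [setValue, assign, Function.comp_def]

theorem Admissible.setValue {dm : Domains} (h : M.Admissible d Ss dm) {v : List ℕ} {a : ℕ}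
    (ha : a ∈ lookup dm v) : M.Admissible d Ss (setValue dm v a) := by
  obtain ⟨δ, rfl, hδ⟩ := h
  refine ⟨_, setValue_assign δ v a, fun w hw => ?_⟩
  by_cases hwv : w = v
  · subst hwv
    rw [lookup_assign _ hw] at ha
    obtain ⟨h1, S, hS, h2⟩ := hδ w hw
    simp only [beq_self_eq_true, cond_true]
    exact ⟨List.singleton_sublist.2 (h1.subset ha), S, hS, by simpa using h2 a ha⟩
  · have : (w == v) = false := by simpa using hwv
    simpa only [this, cond_false] using hδ w hw

theorem narrow_spec {δ : List ℕ → List ℕ} (hs : Solvable cs (M.assign d δ)) {v : List ℕ}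
    (hv : v ∈ M.vars d) : ∃ a ∈ lookup (M.assign d δ) v,
      narrow cs (M.assign d δ) v = setValue (M.assign d δ) v a ∧
        Solvable cs (setValue (M.assign d δ) v a) := by
  obtain ⟨ψ, h1, h2⟩ := hs
  have hψ : ∀ w ∈ M.vars d, ψ w ∈ δ w := fun w hw => h1 _ (List.mem_map.2 ⟨w, hw, rfl⟩)
  have hex : ∃ dm ∈ (lookup (M.assign d δ) v).map fun a => setValue (M.assign d δ) v a,
      Solvable cs dm := by
    refine ⟨_, List.mem_map.2 ⟨ψ v, by rw [lookup_assign _ hv]; exact hψ v hv, rfl⟩, ψ, ?_, h2⟩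
    intro e he
    rw [setValue_assign] at he
    obtain ⟨w, hw, rfl⟩ := List.mem_map.1 he
    by_cases hwv : w = v
    · simp [hwv]
    · have : (w == v) = false := by simpa using hwv
      simpa only [this, cond_false] using hψ w hw
  obtain ⟨h3, h4⟩ := firstSolvable_spec hex
  obtain ⟨a, ha, h5⟩ := List.mem_map.1 h3
  exact ⟨a, ha, h5.symm, h5 ▸ h4⟩

/-- Self-reduction: the value at `v` of any solution is an admissible choice, so solvability
survives each step. Later steps change only the domain of their own variable, so earlier variables
stay fixed. -/
theorem foldl_narrow_spec {dm : Domains} (hdm : M.Admissible d Ss dm) (hs : Solvable cs dm)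
    (l : List (List ℕ)) (hl : ∀ v ∈ l, v ∈ M.vars d) :
    M.Admissible d Ss (l.foldl (fun dm v => narrow cs dm v) dm) ∧
      Solvable cs (l.foldl (fun dm v => narrow cs dm v) dm) ∧
      ∀ v ∈ l, ∃ a, lookup (l.foldl (fun dm v => narrow cs dm v) dm) v = [a] := by
  induction l using List.reverseRecOn with
  | nil => exact ⟨hdm, hs, by simp⟩
  | append_singleton l v ih =>
    obtain ⟨h1, h2, h3⟩ := ih fun w hw => hl w (by simp [hw])
    have hv := hl v (by simp)
    rw [List.foldl_append, List.foldl_cons, List.foldl_nil]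
    obtain ⟨δ, hδ, -⟩ := id h1
    rw [hδ] at h1 h2 h3 ⊢
    obtain ⟨a, ha, h4, h5⟩ := narrow_spec h2 hv
    rw [h4]
    refine ⟨h1.setValue ha, h5, fun w hw => ?_⟩
    rw [setValue_assign, lookup_assign _ (hl w hw)]
    by_cases hwv : w = v
    · exact ⟨a, by simp [hwv]⟩
    · obtain ⟨c, hc⟩ := h3 w (by simpa [hwv] using hw)
      rw [lookup_assign _ (hl w hw)] at hc
      have : (w == v) = false := by simpa using hwv
      exact ⟨c, by simpa only [this, cond_false] using hc⟩

theorem mem_patterns {g : List (List ℕ × ℕ)} (hg : g ∈ M.patterns) :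
    ∀ e ∈ g, e.1 ∈ M.vars (Finset.univ.sup M.arity) ∧ e.2 ∈ e.1.tail := by
  rw [patterns, List.mem_sections, List.forall₂_map_right_iff] at hg
  intro e he
  obtain ⟨n, hn, rfl⟩ := List.getElem_of_mem he
  have h := List.Forall₂.get hg hn (hg.length_eq ▸ hn)
  obtain ⟨p, hp, h⟩ := List.mem_map.1 h
  simp only [List.get_eq_getElem] at h hp
  rw [← h]
  exact ⟨List.getElem_mem _, hp⟩

theorem map_mem_patterns {h : List ℕ → ℕ}
    (hh : ∀ v ∈ M.vars (Finset.univ.sup M.arity), h v ∈ v.tail) :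
    ((M.vars (Finset.univ.sup M.arity)).map fun v => (v, h v)) ∈ M.patterns := by
  rw [patterns, List.mem_sections, List.forall₂_map_left_iff, List.forall₂_map_right_iff,
    List.forall₂_same]
  exact fun v hv => List.mem_map.2 ⟨_, hh v hv, rfl⟩

/-- Variables fixed by the pattern and uncovered variables have one-element domains, which lie in a
singleton of `Ss`. The remaining ones are covered, so their whole argument tuple lies in a member of
`Ss`. -/
theorem admissible_of_mem_startDomains (hpos : ∀ i, 0 < M.arity i)
    (hSs : ∀ a < d, [a] ∈ Ss) {s : List ℕ} {dm : Domains} (hdm : dm ∈ M.startDomains d Ss s) :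
    M.Admissible d Ss dm := by
  obtain ⟨g, hg, rfl⟩ := List.mem_map.1 hdm
  refine ⟨_, rfl, fun v hv => ?_⟩
  have hsingle : ∀ a ∈ v.tail, [a].Sublist v.tail ∧ ∃ S ∈ Ss, ∀ c ∈ [a], c ∈ S := fun a ha =>
    ⟨List.singleton_sublist.2 ha, [a], hSs a (lt_of_mem_vars hv ha), fun _ h => h⟩
  unfold startDomain
  rcases lookup_eq_nil_or (patternDomains g s) v with ⟨-, h⟩ | ⟨e, he, hev, h⟩
  · rw [h, List.isEmpty_nil, cond_true]
    cases hc : covered Ss v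
    · refine hsingle _ ?_
      obtain ⟨i, x, hx, rfl⟩ := mem_vars.1 hv
      have := hpos i
      rw [← hx.1] at this
      cases x with
      | nil => simp at this
      | cons a x => simp
    · exact ⟨List.Sublist.refl _, covered_iff.1 hc⟩
  · obtain ⟨e, he', rfl⟩ := List.mem_map.1 he
    rw [h, List.isEmpty_cons, cond_false]
    refine hsingle _ ?_
    rw [← hev]
    exact List.mem_map_of_mem (mem_patterns hg e he').2

/-- The polymorphisms `F` dictate the right pattern: by conservativity, the value of `F` at a tuple
of entries of `s` is the entry at one of the positions used. With this pattern `F` itself solves all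
constraints covered by `s :: Ss`. -/
theorem exists_solvable_startDomains {F : Fin M.numSymbols → List ℕ → ℕ}
    (hF : M.ConservativePolymorphisms L F) {s : List ℕ}
    (hs : s ∈ (M.vars L.2.1).map List.tail) :
    ∃ dm ∈ M.startDomains L.2.1 Ss s, Solvable (restrict (s :: Ss) (M.indicator L)) dm := by
  have hpos := hF.ops.arity_pos
  have hFmem := (hF.partialSolution []).mem
  have hsol := (hF.partialSolution (s :: Ss)).sat
  obtain ⟨u, hu, rfl⟩ := List.mem_map.1 hs
  obtain ⟨i₀, s, hs', rfl⟩ := mem_vars.1 hu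
  rw [List.tail_cons] at hsol ⊢
  have hsK : s.length ≤ Finset.univ.sup M.arity :=
    hs'.1.trans_le (Finset.le_sup (Finset.mem_univ i₀))
  -- Patterns use positions up to the largest arity, which may exceed the length of `s`. The default
  -- `0` is then a value, because `s` is nonempty.
  have hslt : ∀ p, s.getD p 0 < L.2.1 := by
    have h1 : ∀ p, p < s.length → s.getD p 0 < L.2.1 := fun p hp => hs'.2 _ (getD_mem 0 hp)
    intro p
    by_cases hp : p < s.length
    · exact h1 p hp
    · rw [List.getD_eq_default _ _ (by omega)]
      exact (Nat.zero_le _).trans_lt (h1 0 (hs'.1 ▸ hpos i₀))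
  have hchoice : ∀ v ∈ M.vars (Finset.univ.sup M.arity), ∃ p ∈ v.tail,
      s.getD p 0 = evalVar F (v.headD 0 :: v.tail.map fun p => s.getD p 0) := by
    intro v hv
    obtain ⟨i, π, hπ, rfl⟩ := mem_vars.1 hv
    have := hFmem ((i : ℕ) :: π.map fun p => s.getD p 0) (mem_vars.2 ⟨i, _, ⟨by simpa using hπ.1,
      fun a ha => by
        obtain ⟨p, -, rfl⟩ := List.mem_map.1 ha
        exact hslt p⟩, rfl⟩)
    obtain ⟨p, hp, h⟩ := List.mem_map.1 this
    exact ⟨p, hp, h⟩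
  classical
  let h : List ℕ → ℕ := fun v => if hv : v ∈ M.vars (Finset.univ.sup M.arity) then
    (hchoice v hv).choose else 0
  have hh : ∀ v ∈ M.vars (Finset.univ.sup M.arity), h v ∈ v.tail ∧
      s.getD (h v) 0 = evalVar F (v.headD 0 :: v.tail.map fun p => s.getD p 0) := by
    intro v hv
    simp only [h, hv, dite_true]
    exact (hchoice v hv).choose_spec
  have hg := map_mem_patterns fun v hv => (hh v hv).1
  refine ⟨_, List.mem_map_of_mem hg, ?_⟩
  set g := (M.vars (Finset.univ.sup M.arity)).map fun v => (v, h v)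
  have hin : ∀ v ∈ M.vars L.2.1, covered (s :: Ss) v = true →
      evalVar F v ∈ startDomain Ss (patternDomains g s) v := by
    intro v hv hcov
    unfold startDomain
    rcases lookup_eq_nil_or (patternDomains g s) v with ⟨hnot, hl⟩ | ⟨e, he, hev, hl⟩
    · rw [hl, List.isEmpty_nil, cond_true]
      have : covered Ss v = true := by
        obtain ⟨S, hS, hvS⟩ := covered_iff.1 hcov
        rcases List.mem_cons.1 hS with rfl | hS
        -- A tuple inside `s` is the image of the pattern variable listing the positions of its
        -- entries in `s`, so the pattern must have fixed it.
        · exfalso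
          obtain ⟨i, x, hx, rfl⟩ := mem_vars.1 hv
          have hmem : ∀ a ∈ x, a ∈ S := hvS
          have hw : (i : ℕ) :: x.map (fun a => List.idxOf a S) ∈
              M.vars (Finset.univ.sup M.arity) := by
            refine mem_vars.2 ⟨i, _, ⟨by simpa using hx.1, fun p hp => ?_⟩, rfl⟩
            obtain ⟨a, ha, rfl⟩ := List.mem_map.1 hp
            exact (List.idxOf_lt_length_of_mem (hmem a ha)).trans_le hsK
          refine hnot _ (List.mem_map_of_mem (List.mem_map_of_mem hw)) ?_
          simp only [List.headD_cons, List.tail_cons, List.map_map]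
          congr 1
          conv_rhs => rw [← List.map_id x]
          exact List.map_congr_left fun a ha => getD_idxOf 0 (hmem a ha)
        · exact covered_iff.2 ⟨S, hS, hvS⟩
      rw [this, cond_true]
      exact hFmem v hv
    · obtain ⟨e, he', rfl⟩ := List.mem_map.1 he
      obtain ⟨w, hw, rfl⟩ := List.mem_map.1 he'
      rw [hl, List.isEmpty_cons, cond_false]
      rw [← hev]
      exact List.mem_singleton.2 (hh w hw).2.symm
  have hne : ∀ v, (startDomain Ss (patternDomains g s) v).headD 0 ∈
      startDomain Ss (patternDomains g s) v ∨ v.tail = [] := by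
    intro v
    have : ∀ l : List ℕ, l.headD 0 ∈ l ∨ l = [] := by
      intro l
      cases l <;> simp
    rcases this (startDomain Ss (patternDomains g s) v) with h | h
    · exact Or.inl h
    · right
      unfold startDomain at h
      cases hl : lookup (patternDomains g s) v with
      | nil =>
        rw [hl, List.isEmpty_nil, cond_true] at h
        cases hc : covered Ss v <;> simp_all
      | cons a l => simp [hl] at h
  -- On uncovered variables `F` may leave the one-element domain. Any element of the domain will do
  -- there, since no constraint kept by `restrict` involves them.
  refine ⟨fun v => if evalVar F v ∈ startDomain Ss (patternDomains g s) v then evalVar F v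
    else (startDomain Ss (patternDomains g s) v).headD 0, ?_, ?_⟩
  · intro e he
    obtain ⟨v, hv, rfl⟩ := List.mem_map.1 he
    beta_reduce
    split_ifs with h1
    · exact h1
    · refine (hne v).resolve_right fun h0 => ?_
      have := hFmem v hv
      simp [h0] at this
  · intro c hc
    obtain ⟨hc, hcov⟩ := List.mem_filter.1 hc
    have hcov' : ∀ v ∈ c.1, covered (s :: Ss) v = true := List.all_eq_true.1 hcov
    convert hsol c hc hcov' using 1
    refine List.map_congr_left fun v hv => ?_
    rw [if_pos (hin v ((indicator_scopes hF.wellFormed hc).1 v hv) (hcov' v hv))]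

variable (M) in
/-- The invariant of the algorithm. -/
structure StateInvariant (L : ListInstance) (σ : List (List ℕ) × Domains) : Prop where
  singletons : ∀ a < L.2.1, [a] ∈ σ.1
  solution : M.PartialSolution L σ.1 (value σ.2)
  shape : ∃ δ, σ.2 = M.assign L.2.1 δ ∧ ∀ v ∈ M.vars L.2.1, (δ v).Sublist v.tail

/-- Only constant argument tuples are covered by singletons, and there conservativity forces the
value, so the table agrees with `F` on every constraint that counts. -/
theorem stateInvariant_initialState {F : Fin M.numSymbols → List ℕ → ℕ}
    (hF : M.ConservativePolymorphisms L F) :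
    M.StateInvariant L (M.initialState L.2.1) := by
  have hpos := hF.ops.arity_pos
  have hhead : ∀ v ∈ M.vars L.2.1, v.tail.headD 0 ∈ v.tail := by
    intro v hv
    obtain ⟨i, x, hx, rfl⟩ := mem_vars.1 hv
    have := hpos i
    rw [← hx.1] at this
    cases x with
    | nil => simp at this
    | cons a x => simp
  have hval : ∀ v ∈ M.vars L.2.1, value (M.initialState L.2.1).2 v = v.tail.headD 0 := by
    intro v hv
    simp [value, initialState, lookup_assign _ hv]
  refine ⟨fun a ha => ?_, ⟨fun v hv => ?_, fun c hc hcov => ?_⟩, _, rfl, fun v hv => ?_⟩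
  · exact List.mem_map.2 ⟨a, List.mem_range.2 ha, rfl⟩
  · rw [hval v hv]
    exact hhead v hv
  · have h := hF.partialSolution []
    convert (hF.partialSolution (M.initialState L.2.1).1).sat c hc hcov using 1
    refine List.map_congr_left fun v hv => ?_
    have hv' := (indicator_scopes hF.wellFormed hc).1 v hv
    obtain ⟨S, hS, hvS⟩ := covered_iff.1 (hcov v hv)
    obtain ⟨a, -, rfl⟩ := List.mem_map.1 hS
    rw [hval v hv', List.mem_singleton.1 (hvS _ (hhead v hv')),
      List.mem_singleton.1 (hvS _ (h.mem v hv'))]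
  · exact List.singleton_sublist.2 (hhead v hv)

theorem StateInvariant.start {σ : List (List ℕ) × Domains} {F : Fin M.numSymbols → List ℕ → ℕ}
    (hF : M.ConservativePolymorphisms L F) (h : M.StateInvariant L σ) {s : List ℕ}
    (hs : s ∈ (M.vars L.2.1).map List.tail) :
    M.Admissible L.2.1 σ.1 (firstSolvable (restrict (s :: σ.1) (M.indicator L))
      (M.startDomains L.2.1 σ.1 s)) ∧
    Solvable (restrict (s :: σ.1) (M.indicator L)) (firstSolvable
      (restrict (s :: σ.1) (M.indicator L)) (M.startDomains L.2.1 σ.1 s)) := by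
  obtain ⟨h1, h2⟩ := firstSolvable_spec (exists_solvable_startDomains (Ss := σ.1) hF hs)
  exact ⟨admissible_of_mem_startDomains hF.ops.arity_pos h.singletons h1, h2⟩

/-- After narrowing, every domain has one element, so the table coincides with the solution that
narrowing has kept alive. -/
theorem StateInvariant.extend {σ : List (List ℕ) × Domains} {F : Fin M.numSymbols → List ℕ → ℕ}
    (hF : M.ConservativePolymorphisms L F) (h : M.StateInvariant L σ) {s : List ℕ}
    (hs : s ∈ (M.vars L.2.1).map List.tail) : M.StateInvariant L (M.extend L σ s) := by
  obtain ⟨h1, h2⟩ := h.start hF hs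
  obtain ⟨⟨δ, hδ, hδ'⟩, ⟨ψ, h3, h4⟩, h5⟩ := foldl_narrow_spec h1 h2 (M.vars L.2.1) fun _ h => h
  have hT : (M.extend L σ s).2 = M.assign L.2.1 δ := hδ
  rw [hδ] at h3 h5
  have hval : ∀ v ∈ M.vars L.2.1, value (M.extend L σ s).2 v = ψ v ∧ ψ v ∈ δ v := by
    intro v hv
    obtain ⟨a, ha⟩ := h5 v hv
    have h6 : ψ v ∈ δ v := h3 _ (List.mem_map.2 ⟨v, hv, rfl⟩)
    refine ⟨?_, h6⟩
    rw [hT, value, ha]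
    rw [lookup_assign _ hv] at ha
    rw [ha, List.mem_singleton] at h6
    simp [h6]
  refine ⟨fun a ha => List.mem_cons_of_mem _ (h.singletons a ha), ⟨fun v hv => ?_, ?_⟩,
    δ, hδ, fun v hv => (hδ' v hv).1⟩
  · rw [(hval v hv).1]
    exact (hδ' v hv).1.subset (hval v hv).2
  · intro c hc hcov
    convert h4 c (List.mem_filter.2 ⟨hc, List.all_eq_true.2 hcov⟩) using 1
    exact List.map_congr_left fun v hv =>
      (hval v ((indicator_scopes hF.wellFormed hc).1 v hv)).1

theorem foldl_extend_spec {F : Fin M.numSymbols → List ℕ → ℕ}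
    (hF : M.ConservativePolymorphisms L F) (l : List (List ℕ))
    (hl : ∀ s ∈ l, s ∈ (M.vars L.2.1).map List.tail) :
    M.StateInvariant L (l.foldl (M.extend L) (M.initialState L.2.1)) ∧
      (l.foldl (M.extend L) (M.initialState L.2.1)).1 =
        l.reverse ++ (M.initialState L.2.1).1 := by
  induction l using List.reverseRecOn with
  | nil => exact ⟨stateInvariant_initialState hF, rfl⟩
  | append_singleton l s ih =>
    obtain ⟨h1, h2⟩ := ih fun w hw => hl w (by simp [hw])
    rw [List.foldl_append, List.foldl_cons, List.foldl_nil]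
    refine ⟨h1.extend hF (hl s (by simp)), ?_⟩
    simp [LinearMaltsevCondition.extend, h2]

variable (M) in
/-- The table of polymorphisms that the algorithm finds. -/
noncomputable def finalTable (L : ListInstance) : Domains :=
  (((M.vars L.2.1).map List.tail).foldl (M.extend L) (M.initialState L.2.1)).2

theorem conservativePolymorphisms_finalTable {F : Fin M.numSymbols → List ℕ → ℕ}
    (hF : M.ConservativePolymorphisms L F) :
    M.ConservativePolymorphisms L (M.opsOfTable (M.finalTable L)) := by
  obtain ⟨h1, h2⟩ := foldl_extend_spec hF _ fun _ h => h
  refine h1.solution.conservativePolymorphisms hF.wellFormed fun v hv => ?_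
  -- Each variable is covered by its own argument tuple, which was among the sets added.
  refine covered_iff.2 ⟨v.tail, ?_, fun _ h => h⟩
  rw [h2]
  exact List.mem_append_left _ (List.mem_reverse.2 (List.mem_map_of_mem hv))

end LinearMaltsevCondition

/-! ### The algorithm runs in polynomial time -/

namespace LinearMaltsevCondition

variable {M : LinearMaltsevCondition}

theorem ConservativeOps.congr {d : ℕ} {F G : Fin M.numSymbols → List ℕ → ℕ}
    (hF : M.ConservativeOps d F) (h : ∀ i l, IsTuple d (M.arity i) l → G i l = F i l) :
    M.ConservativeOps d G := by
  refine ⟨fun i l hl => h i l hl ▸ hF.mem i l hl, fun ι hι => ?_⟩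
  have := hF.holds ι hι
  cases ι with
  | opOp i j x y =>
    intro φ hφ
    rw [h _ _ (isTuple_ofFn fun _ => hφ _), h _ _ (isTuple_ofFn fun _ => hφ _)]
    exact this φ hφ
  | opVar i x y =>
    intro φ hφ
    rw [h _ _ (isTuple_ofFn fun _ => hφ _)]
    exact this φ hφ

theorem ConservativeOps.mono {d d' : ℕ} {F : Fin M.numSymbols → List ℕ → ℕ}
    (hF : M.ConservativeOps d F) (h : d' ≤ d) : M.ConservativeOps d' F := by
  refine ⟨fun i l hl => hF.mem i l ⟨hl.1, fun a ha => (hl.2 a ha).trans_le h⟩, fun ι hι => ?_⟩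
  have := hF.holds ι hι
  cases ι with
  | opOp i j x y => exact fun φ hφ => this φ fun n => (hφ n).trans_le h
  | opVar i x y => exact fun φ hφ => this φ fun n => (hφ n).trans_le h

/-- Operations on a fixed finite set can be replaced by polynomial-time functions. -/
theorem ConservativeOps.exists_polyTime {d : ℕ} {F : Fin M.numSymbols → List ℕ → ℕ}
    (hF : M.ConservativeOps d F) :
    ∃ G : Fin M.numSymbols → List ℕ → ℕ, M.ConservativeOps d G ∧ ∀ i, PolyTime (G i) := by
  refine ⟨fun i l => value ((listsOf (List.range d) (M.arity i)).map fun t => (t, [F i t])) l,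
    hF.congr fun i l hl => ?_, fun i => by fun_prop⟩
  have hmem : l ∈ listsOf (List.range d) (M.arity i) := by
    simpa [mem_listsOf, IsTuple] using hl
  rcases lookup_eq_nil_or ((listsOf (List.range d) (M.arity i)).map fun t => (t, [F i t])) l with
    ⟨h, -⟩ | ⟨e, he, hel, h⟩
  · exact absurd rfl (h _ (List.mem_map_of_mem hmem))
  · obtain ⟨t, -, rfl⟩ := List.mem_map.1 he
    obtain rfl : t = l := hel
    rw [value, h]
    rfl

variable (M) in
/-- The inputs on which the semiuniform algorithm is used: the operations given by the table
`x.1` solve the constraints `x.2.1` within the domains `x.2.2`. -/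
def OracleInput (x : Domains × List VarConstraint × Domains) : Prop :=
  ∃ (L : ListInstance) (Ss : List (List ℕ)), L.WellFormed ∧
    M.PartialSolution L Ss (value x.1) ∧ (∀ c ∈ x.2.1, c ∈ M.indicator L) ∧
    M.Admissible L.2.1 Ss x.2.2

-- This is where the semiuniform algorithm enters the search: it is run on the tagged instance with
-- the tables of the mixed operations. The witnesses `L` and `Ss` of the promise are used only for
-- correctness; the program needs just the table, the constraints and the domains.
open Classical in
theorem polyTimeOn_solvable (hM : M.HasSemiuniformAlgorithmForConservative)
    {b : Fin M.numSymbols → List ℕ → ℕ} (hb : M.ConservativeOps 2 b)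
    (hbt : ∀ i, PolyTime (b i)) :
    PolyTimeOn M.OracleInput fun x => decide (Solvable x.2.1 x.2.2) := by
  have h0 : ∀ i, PolyTime fun z : (Domains × List VarConstraint × Domains) × List ℕ =>
      mix (b i) (fun y => value z.1.1 ((i : ℕ) :: y)) z.1.2.2 z.2 := by
    intro i
    have hf : PolyTime fun w : ((Domains × List VarConstraint × Domains) × List ℕ) × List ℕ =>
        value w.1.1.1 ((i : ℕ) :: w.2) := by fun_prop
    have hdm : PolyTime fun z : (Domains × List VarConstraint × Domains) × List ℕ =>
        z.1.2.2 := by fun_prop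
    exact PolyTime.mix (hbt i) hf hdm PolyTime.snd
  have he : PolyTime fun x : Domains × List VarConstraint × Domains =>
      (elements x.2.2).length := by fun_prop
  have h1 := PolyTime.tables M (F := fun (x : Domains × List VarConstraint × Domains) i =>
    mix (b i) (fun y => value x.1 ((i : ℕ) :: y)) x.2.2) he h0
  have h2 : PolyTime fun x : Domains × List VarConstraint × Domains =>
      (taggedInstance x.2.1 x.2.2, M.tables (elements x.2.2).length fun i =>
        mix (b i) (fun y => value x.1 ((i : ℕ) :: y)) x.2.2) := by fun_prop
  refine (hM.polyTimeOn.comp (h2.on M.OracleInput) ?_).congr ?_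
  · rintro ⟨T, cs, dm⟩ ⟨L, Ss, hL, h, hcs, hdm⟩
    exact ⟨_, h.conservativePolymorphisms_mix hL hb hdm hcs, rfl⟩
  · rintro ⟨T, cs, dm⟩ ⟨L, Ss, hL, h, hcs, δ, hδ, -⟩
    obtain rfl : dm = M.assign L.2.1 δ := hδ
    have := sat_taggedInstance (nodup_assign _ _) (PartialSolution.scopesIn hL hcs δ)
    exact decide_eq_decide.2 this

section Search

variable (hO : open Classical in PolyTimeOn M.OracleInput fun x => decide (Solvable x.2.1 x.2.2))

include hO

theorem polyTimeOn_firstSolvable :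
    PolyTimeOn (fun x : Domains × List VarConstraint × List Domains =>
      ∀ dm ∈ x.2.2, M.OracleInput (x.1, x.2.1, dm)) fun x => firstSolvable x.2.1 x.2.2 := by
  classical
  have h : PolyTimeOn (fun x : Domains × List VarConstraint × List Domains =>
      ∀ dm ∈ x.2.2, M.OracleInput (x.1, x.2.1, dm))
      fun x => x.2.2.filter fun dm => decide (Solvable x.2.1 dm) :=
    PolyTimeOn.list_filter
      (Q := fun y : (Domains × List VarConstraint × List Domains) × Domains =>
        M.OracleInput (y.1.1, y.1.2.1, y.2))
      (f := fun x dm => decide (Solvable x.2.1 dm)) (l := fun x => x.2.2)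
      (hO.comp (f := fun y : (Domains × List VarConstraint × List Domains) × Domains =>
        (y.1.1, y.1.2.1, y.2)) (PolyTime.on (by fun_prop) _) fun _ h => h)
      (PolyTime.on (by fun_prop) _) fun x hx dm hdm => hx dm hdm
  have hh : PolyTime fun l : List Domains => l.headD [] := by fun_prop
  exact ((hh.on fun _ => True).comp h fun _ _ => trivial).congr fun x _ => by
    unfold firstSolvable
    congr!

theorem polyTimeOn_narrow :
    PolyTimeOn (fun x : Domains × List VarConstraint × Domains × List ℕ =>
      M.OracleInput (x.1, x.2.1, x.2.2.1)) fun x => narrow x.2.1 x.2.2.1 x.2.2.2 := by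
  refine (polyTimeOn_firstSolvable hO).comp
    (f := fun x : Domains × List VarConstraint × Domains × List ℕ =>
      (x.1, x.2.1, (lookup x.2.2.1 x.2.2.2).map fun a => setValue x.2.2.1 x.2.2.2 a))
    (PolyTime.on (by fun_prop) _) ?_
  rintro ⟨T, cs, dm, v⟩ ⟨L, Ss, hL, h, hcs, hdm⟩ dm' hdm'
  obtain ⟨a, ha, rfl⟩ := List.mem_map.1 hdm'
  exact ⟨L, Ss, hL, h, hcs, hdm.setValue ha⟩

/-- The promise for each query holds because the domains remain admissible for the old sets while
the old table is used throughout. Admissibility also bounds the accumulator, as each domain stays a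
sublist of the argument tuple. -/
theorem polyTimeOn_extend :
    PolyTimeOn (fun x : ListInstance × (List (List ℕ) × Domains) × List ℕ =>
      (∃ F, M.ConservativePolymorphisms x.1 F) ∧ M.StateInvariant x.1 x.2.1 ∧
        x.2.2 ∈ (M.vars x.1.2.1).map List.tail) fun x => M.extend x.1 x.2.1 x.2.2 := by
  set P : ListInstance × (List (List ℕ) × Domains) × List ℕ → Prop := fun x =>
    (∃ F, M.ConservativePolymorphisms x.1 F) ∧ M.StateInvariant x.1 x.2.1 ∧
      x.2.2 ∈ (M.vars x.1.2.1).map List.tail with hP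
  have hinput : ∀ x, P x → ∀ dm, M.Admissible x.1.2.1 x.2.1.1 dm →
      M.OracleInput (x.2.1.2, restrict (x.2.2 :: x.2.1.1) (M.indicator x.1), dm) := by
    rintro ⟨L, ⟨Ss, T⟩, s⟩ ⟨⟨F, hF⟩, hσ, hs⟩ dm hdm
    exact ⟨L, Ss, hF.wellFormed, hσ.solution, fun c hc => List.mem_of_mem_filter hc, hdm⟩
  have hinit : PolyTimeOn P fun x => firstSolvable
      (restrict (x.2.2 :: x.2.1.1) (M.indicator x.1))
      (M.startDomains x.1.2.1 x.2.1.1 x.2.2) := by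
    refine (polyTimeOn_firstSolvable hO).comp
      (f := fun x : ListInstance × (List (List ℕ) × Domains) × List ℕ =>
        (x.2.1.2, restrict (x.2.2 :: x.2.1.1) (M.indicator x.1),
          M.startDomains x.1.2.1 x.2.1.1 x.2.2)) (PolyTime.on (by fun_prop) _) ?_
    intro x hx dm hdm
    obtain ⟨F, hF⟩ := hx.1
    exact hinput x hx dm
      (admissible_of_mem_startDomains hF.ops.arity_pos hx.2.1.singletons hdm)
  have hspec : ∀ x, P x → ∀ l₁ l₂, M.vars x.1.2.1 = l₁ ++ l₂ →
      M.Admissible x.1.2.1 x.2.1.1 (l₁.foldl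
        (fun dm v => narrow (restrict (x.2.2 :: x.2.1.1) (M.indicator x.1)) dm v)
        (firstSolvable (restrict (x.2.2 :: x.2.1.1) (M.indicator x.1))
          (M.startDomains x.1.2.1 x.2.1.1 x.2.2))) := by
    rintro x ⟨⟨F, hF⟩, hσ, hs⟩ l₁ l₂ h
    obtain ⟨h1, h2⟩ := hσ.start hF hs
    exact (foldl_narrow_spec h1 h2 l₁ fun v hv => by simp [h, hv]).1
  have hB : PolyTime fun x : ListInstance × (List (List ℕ) × Domains) × List ℕ =>
      M.assign x.1.2.1 fun v => v.tail := by fun_prop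
  have hfold := PolyTimeOn.foldl (P := P) (l := fun x => M.vars x.1.2.1)
    (step := fun x dm v => narrow (restrict (x.2.2 :: x.2.1.1) (M.indicator x.1)) dm v)
    (Q := fun y => M.OracleInput (y.1.2.1.2,
      restrict (y.1.2.2 :: y.1.2.1.1) (M.indicator y.1.1), y.2.1))
    (PolyTime.on (by fun_prop) _) hinit
    ((polyTimeOn_narrow hO).comp
      (f := fun y : (ListInstance × (List (List ℕ) × Domains) × List ℕ) × Domains × List ℕ =>
        (y.1.2.1.2, restrict (y.1.2.2 :: y.1.2.1.1) (M.indicator y.1.1), y.2.1, y.2.2))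
      (PolyTime.on (by fun_prop) _) fun _ h => h)
    (fun x hx l₁ v l₂ h => hinput x hx _ (hspec x hx l₁ _ h))
    (hB.on P).bounded (by
      intro x hx l₁ l₂ h
      obtain ⟨δ, hδ, hδ'⟩ := hspec x hx l₁ l₂ h
      rw [hδ]
      exact esize_assign_le fun v hv => (hδ' v hv).1)
  have hcons : PolyTime fun x : ListInstance × (List (List ℕ) × Domains) × List ℕ =>
      x.2.2 :: x.2.1.1 := by fun_prop
  exact (hcons.on P).pair hfold

theorem polyTimeOn_finalTable :
    PolyTimeOn (fun L : ListInstance => ∃ F, M.ConservativePolymorphisms L F) M.finalTable := by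
  have hB : PolyTime fun L : ListInstance => ((M.vars L.2.1).map fun v => v.tail,
      (M.initialState L.2.1).1, M.assign L.2.1 fun v => v.tail) := by fun_prop
  have h := PolyTimeOn.foldl (P := fun L : ListInstance => ∃ F, M.ConservativePolymorphisms L F)
    (l := fun L => (M.vars L.2.1).map fun v => v.tail) (init := fun L => M.initialState L.2.1)
    (step := M.extend) (PolyTime.on (by fun_prop) _) (PolyTime.on (by fun_prop) _)
    (polyTimeOn_extend hO) ?_ (hB.on _).bounded ?_
  · exact (PolyTime.snd.on fun _ => True).comp h fun _ _ => trivial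
  · rintro L ⟨F, hF⟩ l₁ s l₂ h
    have hs : s ∈ (M.vars L.2.1).map List.tail := by
      change s ∈ (M.vars L.2.1).map fun v => v.tail
      rw [h]
      simp
    refine ⟨⟨F, hF⟩, (foldl_extend_spec hF l₁ fun w hw => ?_).1, hs⟩
    change w ∈ (M.vars L.2.1).map fun v => v.tail
    rw [h]
    simp [hw]
  · rintro L ⟨F, hF⟩ l₁ l₂ h
    obtain ⟨h1, h2⟩ := foldl_extend_spec hF l₁ fun w hw => by
      change w ∈ (M.vars L.2.1).map fun v => v.tail
      rw [h]
      simp [hw]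
    -- The two components of the state are bounded separately: the sets are initial ones or argument
    -- tuples from the list, and the table is bounded by the full domains.
    obtain ⟨δ, hδ, hδ'⟩ := h1.shape
    have h3 : esize (M.assign L.2.1 δ) ≤ esize (M.assign L.2.1 fun v => v.tail) :=
      esize_assign_le hδ'
    have h4 := esize_append_le l₁.reverse (M.initialState L.2.1).1
    have h5 := esize_append l₁ l₂
    have h6 := esize_pos l₂
    rw [esize_reverse] at h4
    rw [← Prod.mk.eta (p := l₁.foldl (M.extend L) (M.initialState L.2.1)), h2, hδ]
    simp only [esize_pair, h]
    omega

end Search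

-- The operations `b` depend on `M` only, so they can be built into the program as finite tables.
-- The semiuniform algorithm is used a last time on the original instance, with the operations found
-- by the search.
open Classical in
theorem hasUniformAlgorithmForConservative_of_conservativeOps
    (hM : M.HasSemiuniformAlgorithmForConservative) {b : Fin M.numSymbols → List ℕ → ℕ}
    (hb : M.ConservativeOps 2 b) : M.HasUniformAlgorithmForConservative := by
  obtain ⟨b, hb, hbt⟩ := hb.exists_polyTime
  refine hasUniformAlgorithmForConservative_of_polyTimeOn ?_
  have hT := polyTimeOn_finalTable (polyTimeOn_solvable hM hb hbt)
  have h1 : PolyTime fun x : ListInstance × Domains =>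
      (x.1, M.tables x.1.2.1 (M.opsOfTable x.2)) := by
    have : PolyTime fun x : ListInstance × Domains => M.tables x.1.2.1 (M.opsOfTable x.2) :=
      PolyTime.tables M (by fun_prop) fun i => by
        unfold opsOfTable
        fun_prop
    fun_prop
  have h2 := (h1.on fun _ => True).comp ((PolyTime.id.on _).pair hT) fun _ _ => trivial
  refine hM.polyTimeOn.comp h2 ?_
  rintro L ⟨F, hF⟩
  exact ⟨_, conservativePolymorphisms_finalTable hF, rfl⟩

open Classical in
/-- If `M` is not satisfied by conservative operations on two values, there is at most one
value. -/
theorem hasUniformAlgorithmForConservative_of_forall_not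
    (h : ∀ b, ¬ M.ConservativeOps 2 b) : M.HasUniformAlgorithmForConservative := by
  refine hasUniformAlgorithmForConservative_of_polyTimeOn ?_
  -- With at most one value, the constant `0` is the only candidate assignment. It works exactly
  -- when a value exists or there are no variables, and no relation is empty.
  have h1 : PolyTime fun L : ListInstance =>
      (L.1 == 0 || (L.2.1 == 0).not) && L.2.2.all fun c => c.2.isEmpty.not := by fun_prop
  refine (h1.on _).congr ?_
  rintro ⟨n, d, cs⟩ ⟨F, hF⟩
  have hd : d < 2 := by
    by_contra hd
    exact h F (hF.ops.mono (Nat.le_of_not_lt hd))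
  rw [Bool.eq_iff_iff]
  simp only [Bool.and_eq_true, Bool.or_eq_true, beq_iff_eq, Bool.not_eq_true', List.all_eq_true,
    List.isEmpty_eq_false_iff, decide_eq_true_eq, beq_eq_false_iff_ne]
  constructor
  · rintro ⟨h1, h2⟩
    refine ⟨fun _ => 0, fun v hv => ?_, fun c hc => ?_⟩
    · have hv' : v < n := hv
      change 0 < d
      omega
    · obtain ⟨t, ht⟩ := List.exists_mem_of_ne_nil _ (h2 c hc)
      obtain ⟨h3, h4⟩ := (hF.wellFormed c hc).2 t ht
      convert ht using 1
      refine List.ext_getElem (by simp [h3]) fun j _ hj => ?_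
      have : t[j] < d := h4 _ (List.getElem_mem hj)
      rw [List.getElem_map]
      omega
  · rintro ⟨φ, h1, h2⟩
    refine ⟨?_, fun c hc => List.ne_nil_of_mem (h2 c hc)⟩
    by_contra h0
    push Not at h0
    have : φ 0 < d := h1 0 (by simpa using Nat.pos_of_ne_zero h0.1)
    omega

end LinearMaltsevCondition

end ConsCSP

/-- A linear strong Mal'tsev condition that has a semiuniform polynomial-time algorithm for
conservative languages also has a uniform polynomial-time algorithm for conservative languages. -/
theorem mainTheorem3 (M : ConsCSP.LinearMaltsevCondition)
    (hM : M.HasSemiuniformAlgorithmForConservative) :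
    M.HasUniformAlgorithmForConservative := by
  by_cases h : ∃ b, M.ConservativeOps 2 b
  · obtain ⟨b, hb⟩ := h
    exact ConsCSP.LinearMaltsevCondition.hasUniformAlgorithmForConservative_of_conservativeOps
      hM hb
  · exact ConsCSP.LinearMaltsevCondition.hasUniformAlgorithmForConservative_of_forall_not
      fun b hb => h ⟨b, hb⟩
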